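/- **Theorem (SimTT).** $\mathsf{KS}$ polynomially simulates truth tables. Here formulae are built from literals $a,\bar a$ and the units $\top,\bot$ by $\wedge,\vee$. $\mathsf{KS}$ is the deep inference system with the rules $$\frac{\top}{a\vee\bar a},\qquad \frac{\bot}{a},\qquad \frac{a\vee a}{a},\qquad \frac{A\wedge(B\vee C)}{(A\wedge B)\vee C},\qquad \frac{(A\wedge B)\vee(C\wedge D)}{(A\vee C)\wedge(B\vee D)}$$ ($a$ a literal), together with the rule $=$, which replaces a formula by one equal to it modulo the congruence generated by associativity and commutativity of $\wedge$ and $\vee$ and by $A\vee\bot=A$, $A\wedge\top=A$, $\top\vee\top=\top$, $\bot\wedge\bot=\bot$. Derivations are built from formulae by composing derivations with $\wedge$ and $\vee$ and by composing them vertically with inference steps; a proof is a derivation with premiss $\top$, and its size is its number of atom occurrences. A truth-table proof of $\tau$ is a table with one row for each assignment to the variables of $\tau$, one column for each variable and for each subformula occurrence of $\tau$, the entries being the truth values, and with only the value "true" in the column of $\tau$; its size is its number of entries. Precisely: there are a polynomial-time algorithm and a polynomial $p$ such that, for every formula $\tau$, the algorithm transforms each truth-table proof of $\tau$, of size $s$,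 into a $\mathsf{KS}$ proof of $\tau$ of size at most $p(s)$. -/

import Mathlib

namespace DeepInference

/-! ## Formulae -/

/-- Formulae in negation normal form.  `lit v true` is the propositional variable `v`, and
`lit v false` is its dual. -/
inductive Formula : Type
  | top : Formula
  | bot : Formula
  | lit : ℕ → Bool → Formula
  | and : Formula → Formula → Formula
  | or : Formula → Formula → Formula
  deriving DecidableEq

namespace Formula

/-- Truth value under an assignment. -/
def eval (v : ℕ → Bool) : Formula → Bool
  | top => true
  | bot => false
  | lit x b => v x == b
  | and A B => A.eval v && B.eval v
  | or A B => A.eval v || B.eval v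

/-- The number of atom (literal) occurrences. -/
def size : Formula → ℕ
  | top => 0
  | bot => 0
  | lit _ _ => 1
  | and A B => A.size + B.size
  | or A B => A.size + B.size

/-- The variables of a formula, with repetitions. -/
def vars : Formula → List ℕ
  | top => []
  | bot => []
  | lit x _ => [x]
  | and A B => A.vars ++ B.vars
  | or A B => A.vars ++ B.vars

/-- The list of all subformula occurrences; the formula itself comes last. -/
def subformulas : Formula → List Formula
  | top => [top]
  | bot => [bot]
  | lit x b => [lit x b]
  | and A B => A.subformulas ++ B.subformulas ++ [and A B]
  | or A B => A.subformulas ++ B.subformulas ++ [or A B]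

/-- The equational theory behind the logical rule `=`: commutativity, associativity and unit
equations, closed under reflexivity, symmetry, transitivity and context closure. -/
inductive Eqv : Formula → Formula → Prop
  | refl (A : Formula) : Eqv A A
  | symm {A B : Formula} : Eqv A B → Eqv B A
  | trans {A B C : Formula} : Eqv A B → Eqv B C → Eqv A C
  | and_ctx (C : Formula) {A B : Formula} : Eqv A B → Eqv (and C A) (and C B)
  | or_ctx (C : Formula) {A B : Formula} : Eqv A B → Eqv (or C A) (or C B)
  | or_comm (A B : Formula) : Eqv (or A B) (or B A)
  | and_comm (A B : Formula) : Eqv (and A B) (and B A)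
  | or_assoc (A B C : Formula) : Eqv (or (or A B) C) (or A (or B C))
  | and_assoc (A B C : Formula) : Eqv (and (and A B) C) (and A (and B C))
  | or_bot (A : Formula) : Eqv (or A bot) A
  | and_top (A : Formula) : Eqv (and A top) A
  | top_or_top : Eqv (or top top) top
  | bot_and_bot : Eqv (and bot bot) bot

end Formula

/-! ## Rules, systems, derivations -/

/-- Names of the inference rules of deep inference. -/
inductive Rule : Type
  | eq | identity | weakening | contraction | cut | coweakening | cocontraction | switch | medial

/-- `ρ.Inst A B`: the step with premiss `A` and conclusion `B` is an instance of `ρ`. -/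
inductive Rule.Inst : Rule → Formula → Formula → Prop
  | eq {A B : Formula} : Formula.Eqv A B → Rule.Inst .eq A B
  | identity (x : ℕ) (b : Bool) :
      Rule.Inst .identity .top (.or (.lit x b) (.lit x !b))
  | weakening (x : ℕ) (b : Bool) : Rule.Inst .weakening .bot (.lit x b)
  | contraction (x : ℕ) (b : Bool) :
      Rule.Inst .contraction (.or (.lit x b) (.lit x b)) (.lit x b)
  | cut (x : ℕ) (b : Bool) : Rule.Inst .cut (.and (.lit x b) (.lit x !b)) .bot
  | coweakening (x : ℕ) (b : Bool) : Rule.Inst .coweakening (.lit x b) .top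
  | cocontraction (x : ℕ) (b : Bool) :
      Rule.Inst .cocontraction (.lit x b) (.and (.lit x b) (.lit x b))
  | switch (A B C : Formula) :
      Rule.Inst .switch (.and A (.or B C)) (.or (.and A B) C)
  | medial (A B C D : Formula) :
      Rule.Inst .medial (.or (.and A B) (.and C D)) (.and (.or A C) (.or B D))

/-- The system `KS`; the rule `=` belongs to every system. -/
def KS : Set Rule :=
  {.eq, .identity, .weakening, .contraction, .switch, .medial}

/-- The syntax of derivations: formulae, closed under horizontal composition by a connective and
under vertical composition by an inference step.  In `step ρ Φ Ψ`, `Φ` is above `Ψ`. -/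
inductive Derivation : Type
  | fm : Formula → Derivation
  | and : Derivation → Derivation → Derivation
  | or : Derivation → Derivation → Derivation
  | step : Rule → Derivation → Derivation → Derivation

namespace Derivation

/-- The premiss. -/
def pr : Derivation → Formula
  | fm A => A
  | and Φ Ψ => .and Φ.pr Ψ.pr
  | or Φ Ψ => .or Φ.pr Ψ.pr
  | step _ Φ _ => Φ.pr

/-- The conclusion. -/
def cn : Derivation → Formula
  | fm A => A
  | and Φ Ψ => .and Φ.cn Ψ.cn
  | or Φ Ψ => .or Φ.cn Ψ.cn
  | step _ _ Ψ => Ψ.cn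

/-- All inference steps are correct instances of rules in the system `S`. -/
def Correct (S : Set Rule) : Derivation → Prop
  | fm _ => True
  | and Φ Ψ => Φ.Correct S ∧ Ψ.Correct S
  | or Φ Ψ => Φ.Correct S ∧ Ψ.Correct S
  | step ρ Φ Ψ => Φ.Correct S ∧ Ψ.Correct S ∧ ρ ∈ S ∧ ρ.Inst Φ.cn Ψ.pr

/-- A proof in `S` is a correct derivation in `S` with premiss `⊤`. -/
def IsProof (S : Set Rule) (Φ : Derivation) : Prop :=
  Φ.Correct S ∧ Φ.pr = .top

/-- The number of atom occurrences. -/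
def size : Derivation → ℕ
  | fm A => A.size
  | and Φ Ψ => Φ.size + Ψ.size
  | or Φ Ψ => Φ.size + Ψ.size
  | step _ Φ Ψ => Φ.size + Ψ.size

end Derivation

/-! ## Truth tables -/

/-- A table for a formula: a list of rows, each of which is a list of truth values. -/
structure TruthTable : Type where
  formula : Formula
  rows : List (List Bool)

namespace TruthTable

/-- The columns: one for each variable of `A` and then one for each subformula occurrence of `A`,
the last one being the column of `A` itself. -/
def columns (A : Formula) : List Formula :=
  A.vars.dedup.map (fun x => Formula.lit x true) ++ A.subformulas

/-- The row of the assignment `v`. -/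
def row (A : Formula) (v : ℕ → Bool) : List Bool :=
  (columns A).map (Formula.eval v)

/-- `T` is a truth-table proof of `T.formula`: its rows are, in some order and each exactly once,
the rows of all assignments to the variables of the formula, and every entry in the last column is
`true`. -/
def IsProof (T : TruthTable) : Prop :=
  T.rows.Nodup ∧
  (∀ r, r ∈ T.rows ↔ ∃ v : ℕ → Bool, r = row T.formula v) ∧
  ∀ r ∈ T.rows, r.getLast? = some true

/-- The number of entries of the table. -/
def size (T : TruthTable) : ℕ := (T.rows.map List.length).sum

end TruthTable

/-! ## A machine model with running time

Data are binary trees.  Programs are deterministic and are built from elementary operations on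
trees by pairing, sequential composition, conditionals and while loops.  Every elementary operation
is charged the sizes of the trees it reads and writes, so that all trees occurring in a run have
size at most the running time; thus polynomial time is the usual notion. -/

inductive Data : Type
  | nil : Data
  | cons : Data → Data → Data
  deriving DecidableEq

namespace Data

/-- The number of nodes. -/
def size : Data → ℕ
  | nil => 1
  | cons a b => a.size + b.size + 1

def hd : Data → Data
  | nil => nil
  | cons a _ => a

def tl : Data → Data
  | nil => nil
  | cons _ b => b

/-- Truth values; in tests, every tree other than `nil` counts as true. -/
def ofBool : Bool → Data
  | false => nil
  | true => cons nil nil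

def ofList : List Data → Data
  | [] => nil
  | a :: l => cons a (ofList l)

/-- Natural numbers in binary, least significant bit first. -/
def ofNat (n : ℕ) : Data := ofList ((Nat.bits n).map ofBool)

/-- Tags used to distinguish constructors. -/
def tag : ℕ → Data
  | 0 => nil
  | n + 1 => cons nil (tag n)

end Data

inductive Program : Type
  | id : Program
  | const : Data → Program
  | hd : Program
  | tl : Program
  /-- Compares the two components of the input. -/
  | eq : Program
  /-- Runs two programs on the input and pairs their outputs. -/
  | pair : Program → Program → Program
  /-- `seq P Q` runs `P` and then `Q` on the output of `P`. -/
  | seq : Program → Program → Program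
  /-- `cond C P Q` runs `P` if the output of `C` is true, and `Q` otherwise. -/
  | cond : Program → Program → Program → Program
  /-- `loop C P` replaces the current value by the output of `P` on it, as long as the output of
  `C` on the current value is true. -/
  | loop : Program → Program → Program

/-- `Runs P x y t`: on input `x`, the program `P` halts with output `y` after time `t`. -/
inductive Program.Runs : Program → Data → Data → ℕ → Prop
  | id (x : Data) : Runs .id x x x.size
  | const (d x : Data) : Runs (.const d) x d (x.size + d.size)
  | hd (x : Data) : Runs .hd x x.hd x.size
  | tl (x : Data) : Runs .tl x x.tl x.size
  | eq (x : Data) : Runs .eq x (Data.ofBool (decide (x.hd = x.tl))) (x.size + 3)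
  | pair {P Q : Program} {x y z : Data} {s t : ℕ} :
      Runs P x y s → Runs Q x z t → Runs (.pair P Q) x (.cons y z) (s + t + 1)
  | seq {P Q : Program} {x y z : Data} {s t : ℕ} :
      Runs P x y s → Runs Q y z t → Runs (.seq P Q) x z (s + t + 1)
  | cond_true {C P Q : Program} {x c y : Data} {s t : ℕ} :
      Runs C x c s → c ≠ .nil → Runs P x y t → Runs (.cond C P Q) x y (s + t + 1)
  | cond_false {C P Q : Program} {x y : Data} {s t : ℕ} :
      Runs C x .nil s → Runs Q x y t → Runs (.cond C P Q) x y (s + t + 1)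
  | loop_done {C P : Program} {x : Data} {s : ℕ} :
      Runs C x .nil s → Runs (.loop C P) x x (s + 1)
  | loop_step {C P : Program} {x c y z : Data} {r s t : ℕ} :
      Runs C x c r → c ≠ .nil → Runs P x y s → Runs (.loop C P) y z t →
        Runs (.loop C P) x z (r + s + t + 1)

/-! ## Encodings of formulae, derivations and truth tables -/

def Formula.code : Formula → Data
  | .top => .cons (.tag 0) .nil
  | .bot => .cons (.tag 1) .nil
  | .lit x b => .cons (.tag 2) (.cons (.ofBool b) (.ofNat x))
  | .and A B => .cons (.tag 3) (.cons A.code B.code)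
  | .or A B => .cons (.tag 4) (.cons A.code B.code)

def Rule.code : Rule → Data
  | .eq => .tag 0
  | .identity => .tag 1
  | .weakening => .tag 2
  | .contraction => .tag 3
  | .cut => .tag 4
  | .coweakening => .tag 5
  | .cocontraction => .tag 6
  | .switch => .tag 7
  | .medial => .tag 8

def Derivation.code : Derivation → Data
  | .fm A => .cons (.tag 0) A.code
  | .and Φ Ψ => .cons (.tag 1) (.cons Φ.code Ψ.code)
  | .or Φ Ψ => .cons (.tag 2) (.cons Φ.code Ψ.code)
  | .step ρ Φ Ψ => .cons (.tag 3) (.cons ρ.code (.cons Φ.code Ψ.code))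

def TruthTable.code (T : TruthTable) : Data :=
  .cons T.formula.code (.ofList (T.rows.map fun r => .ofList (r.map Data.ofBool)))

/-! ## Polynomial simulation -/

/-- A propositional proof system: its proofs among a type of candidates, their conclusions, their
sizes, and their codes as inputs or outputs of programs. -/
structure ProofSystem where
  Candidate : Type
  IsProof : Candidate → Prop
  conclusion : Candidate → Formula
  size : Candidate → ℕ
  code : Candidate → Data

/-- The deep inference system with set of rules `S`. -/
def deepInference (S : Set Rule) : ProofSystem where
  Candidate := Derivation
  IsProof := Derivation.IsProof S
  conclusion := Derivation.cn
  size := Derivation.size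
  code := Derivation.code

/-- The method of truth tables. -/
def truthTables : ProofSystem where
  Candidate := TruthTable
  IsProof := TruthTable.IsProof
  conclusion := TruthTable.formula
  size := TruthTable.size
  code := TruthTable.code

/-- `S` polynomially simulates `T`: some polynomial-time program transforms each proof in `T` into
a proof in `S` of the same conclusion, whose size is polynomially bounded in the size of the given
proof. -/
def PolynomiallySimulates (S T : ProofSystem) : Prop :=
  ∃ (P : Program) (p q : Polynomial ℕ), ∀ τ : T.Candidate, T.IsProof τ →
    ∃ σ : S.Candidate, S.IsProof σ ∧ S.conclusion σ = T.conclusion τ ∧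
      S.size σ ≤ p.eval (T.size τ) ∧
      ∃ t : ℕ, t ≤ q.eval (T.code τ).size ∧ P.Runs (T.code τ) (S.code σ) t

end DeepInference

namespace DeepInference

/-! ## Polynomial-time functions between encoded types -/

/-! A tautology `A` is proved by case distinction on its variables, without cut or cocontraction.
Let `x` be a variable of `A`, let `A₁` and `A₀` be `A` with `x` set to true and to false, and let
`Y` (`negPart`) be the conjunction with one conjunct `¬x` for each occurrence of `¬x` in `A`, and
`⊤` for every other leaf. Two derivations carry the argument.

`expand` leads from `A₁` to `A ∨ Y`. Where `x` was replaced by `⊤`, there is a proof of `x ∨ Y`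
(`exclMid`); where `¬x` was replaced by `⊥`, weakening yields `¬x ∨ Y`; any other leaf `a` is
weakened to `a ∨ Y`. The copies of `Y` move outwards by switch and are contracted.

`assemble` leads from `Y ∧ A₀` to `A`. Switch delivers each conjunct of `Y` to its own leaf, where
`¬x ∧ ⊤ = ¬x`; an occurrence of `x`, now `⊥`, is restored by weakening. Since `Y` has as many copies
of `¬x` as `A`, nothing is ever duplicated.

Together, `⊤ → A₁ → A ∨ Y = A ∨ (Y ∧ ⊤) → A ∨ (Y ∧ A₀) → A ∨ A → A` (`shannon`). The proofs of `A₁`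
and `A₀` are each used once and the rest has size cubic in `A`. As restriction never enlarges a
formula, `k` variables give size `O(2 ^ k * |A| ^ 3)` (`msize_build_le`). A truth table for `A` has
at least `2 ^ k` rows (`two_pow_le`), so this is polynomial in the table.

For the running time, `PolyTime` is shown to be closed under pairing, composition, conditionals,
bounded loops and, by means of an explicit stack, binary recursion with polynomially many
subproblems (`treeRecursion`). Recursion on formulae and the recursion of `build` are both instances
of the latter. -/

class Enc (α : Type) where
  code : α → Data

namespace Enc

/-- The size of the code. -/
def len {α : Type} [Enc α] (a : α) : ℕ := (code a).size

instance : Enc Data := ⟨fun d => d⟩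
instance : Enc Bool := ⟨Data.ofBool⟩
instance : Enc ℕ := ⟨Data.ofNat⟩
instance : Enc Formula := ⟨Formula.code⟩
instance : Enc Derivation := ⟨Derivation.code⟩
instance : Enc Rule := ⟨Rule.code⟩
instance {α β : Type} [Enc α] [Enc β] : Enc (α × β) := ⟨fun a => .cons (code a.1) (code a.2)⟩
instance {α : Type} [Enc α] : Enc (List α) := ⟨fun l => .ofList (l.map code)⟩
-- Inputs are restricted to correct tables, since only these have enough rows to pay for an
-- exponential construction.
instance : Enc {T : TruthTable // T.IsProof} := ⟨fun T => T.1.code⟩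

end Enc

open Enc

@[simp] theorem Enc.len_prod {α β : Type} [Enc α] [Enc β] (a : α) (b : β) :
    len (a, b) = len a + len b + 1 := rfl

@[simp] theorem Enc.len_nil {α : Type} [Enc α] : len ([] : List α) = 1 := rfl

@[simp] theorem Enc.len_cons {α : Type} [Enc α] (a : α) (l : List α) :
    len (a :: l) = len a + len l + 1 := rfl

theorem Data.size_pos (d : Data) : 1 ≤ d.size := by cases d <;> simp [Data.size]

theorem Enc.len_pos {α : Type} [Enc α] (a : α) : 1 ≤ len a := Data.size_pos _

theorem Enc.len_bool_le (b : Bool) : len b ≤ 3 := by cases b <;> decide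

theorem Data.ofBool_injective : Function.Injective Data.ofBool := by
  intro a b h; cases a <;> cases b <;> simp_all [Data.ofBool]

theorem Data.ofList_injective : Function.Injective Data.ofList := by
  intro a
  induction a with
  | nil => intro b h; cases b <;> simp_all [Data.ofList]
  | cons x l ih =>
    intro b h
    cases b with
    | nil => simp [Data.ofList] at h
    | cons y m =>
      simp only [Data.ofList, Data.cons.injEq] at h
      rw [h.1, ih h.2]

theorem Data.ofNat_injective : Function.Injective Data.ofNat := by
  intro a b h
  have h' := List.map_injective_iff.2 Data.ofBool_injective (Data.ofList_injective h)
  exact Nat.eq_of_testBit_eq fun i => by rw [Nat.testBit_eq_inth, h', Nat.testBit_eq_inth]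

theorem eval_mono (p : Polynomial ℕ) {m n : ℕ} (h : m ≤ n) : p.eval m ≤ p.eval n := by
  simp only [Polynomial.eval_eq_sum, Polynomial.sum]
  gcongr

/-- Every elementary operation pays for what it reads and writes. Hence outputs of polynomial-time
programs are polynomially long, which is what composition needs. -/
theorem Program.Runs.size_le {P : Program} {x y : Data} {t : ℕ} (h : P.Runs x y t) :
    x.size ≤ t ∧ y.size ≤ t := by
  induction h with
  | id x => simp
  | const d x => simp
  | hd x => cases x <;> simp [Data.hd, Data.size]; omega
  | tl x => cases x <;> simp [Data.tl, Data.size]; omega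
  | eq x =>
    refine ⟨by omega, ?_⟩
    cases decide (x.hd = x.tl) <;> simp [Data.ofBool, Data.size]
  | pair _ _ ih1 ih2 => simp only [Data.size]; omega
  | seq _ _ ih1 ih2 => omega
  | cond_true _ _ _ ih1 ih2 => omega
  | cond_false _ _ ih1 ih2 => omega
  | loop_done _ ih => omega
  | loop_step _ _ _ _ ih1 ih2 ih3 => omega

/-- Computable by a program in time polynomial in the size of the code of the argument. -/
@[fun_prop]
def PolyTime {α β : Type} [Enc α] [Enc β] (f : α → β) : Prop :=
  ∃ (P : Program) (q : Polynomial ℕ), ∀ a,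
    ∃ t, t ≤ q.eval (len a) ∧ P.Runs (code a) (code (f a)) t

/-! ### Closure properties of polynomial-time functions -/

namespace PolyTime

variable {α β γ δ : Type} [Enc α] [Enc β] [Enc γ] [Enc δ]

theorem of_code_eq {f : α → β} (h : ∀ a, code (f a) = code a) : PolyTime f :=
  ⟨.id, .X, fun a => ⟨(code a).size, by simp [len], by rw [h]; exact .id _⟩⟩

@[fun_prop]
theorem id : PolyTime fun a : α => a := of_code_eq fun _ => rfl

@[fun_prop]
theorem const (b : β) : PolyTime fun _ : α => b :=
  ⟨.const (code b), .X + .C (code b).size, fun a => ⟨_, by simp [len], .const _ _⟩⟩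

@[fun_prop]
theorem comp {g : β → γ} {f : α → β} (hg : PolyTime g) (hf : PolyTime f) :
    PolyTime fun a => g (f a) := by
  obtain ⟨P, p, hP⟩ := hf
  obtain ⟨Q, q, hQ⟩ := hg
  refine ⟨.seq P Q, p + q.comp p + 1, fun a => ?_⟩
  obtain ⟨s, hs, hs'⟩ := hP a
  obtain ⟨t, ht, ht'⟩ := hQ (f a)
  refine ⟨_, ?_, .seq hs' ht'⟩
  have := ht.trans (eval_mono q (hs'.size_le.2.trans hs))
  simp only [Polynomial.eval_add, Polynomial.eval_comp, Polynomial.eval_one]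
  omega

/-- A function is polynomial-time if its code is that of a polynomial-time function. -/
theorem congr_code {f : α → β} {g : α → γ} (hg : PolyTime g) (h : ∀ a, code (f a) = code (g a)) :
    PolyTime f := by
  obtain ⟨P, p, hP⟩ := hg
  exact ⟨P, p, fun a => by rw [h]; exact hP a⟩

@[fun_prop]
theorem prodMk {f : α → β} {g : α → γ} (hf : PolyTime f) (hg : PolyTime g) :
    PolyTime fun a => (f a, g a) := by
  obtain ⟨P, p, hP⟩ := hf
  obtain ⟨Q, q, hQ⟩ := hg
  refine ⟨.pair P Q, p + q + 1, fun a => ?_⟩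
  obtain ⟨s, hs, hs'⟩ := hP a
  obtain ⟨t, ht, ht'⟩ := hQ a
  refine ⟨_, ?_, .pair hs' ht'⟩
  simp only [Polynomial.eval_add, Polynomial.eval_one]
  omega

/-- Pairing at the level of codes. -/
theorem dataCons {f : α → β} {g : α → γ} (hf : PolyTime f) (hg : PolyTime g) :
    PolyTime fun a => Data.cons (code (f a)) (code (g a)) :=
  (hf.prodMk hg).congr_code fun _ => rfl

theorem dataHd : PolyTime Data.hd := ⟨.hd, .X, fun a => ⟨_, by simp [len, code], .hd _⟩⟩

theorem dataTl : PolyTime Data.tl := ⟨.tl, .X, fun a => ⟨_, by simp [len, code], .tl _⟩⟩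

theorem toCode : PolyTime (code : α → Data) := of_code_eq fun _ => rfl

@[fun_prop]
theorem fst {f : α → β × γ} (hf : PolyTime f) : PolyTime fun a => (f a).1 :=
  (dataHd.comp (toCode.comp hf)).congr_code fun _ => rfl

@[fun_prop]
theorem snd {f : α → β × γ} (hf : PolyTime f) : PolyTime fun a => (f a).2 :=
  (dataTl.comp (toCode.comp hf)).congr_code fun _ => rfl

@[fun_prop]
theorem bcond {c : α → Bool} {f g : α → β} (hc : PolyTime c) (hf : PolyTime f) (hg : PolyTime g) :
    PolyTime fun a => bif c a then f a else g a := by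
  obtain ⟨R, r, hR⟩ := hc
  obtain ⟨P, p, hP⟩ := hf
  obtain ⟨Q, q, hQ⟩ := hg
  refine ⟨.cond R P Q, r + p + q + 1, fun a => ?_⟩
  obtain ⟨u, hu, hu'⟩ := hR a
  obtain ⟨s, hs, hs'⟩ := hP a
  obtain ⟨t, ht, ht'⟩ := hQ a
  simp only [Polynomial.eval_add, Polynomial.eval_one]
  cases h : c a
  · rw [h] at hu'
    exact ⟨_, by omega, .cond_false hu' ht'⟩
  · rw [h] at hu'
    exact ⟨_, by omega, .cond_true hu' (by simp [code, Data.ofBool]) hs'⟩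

theorem decide_data_eq {f g : α → Data} (hf : PolyTime f) (hg : PolyTime g) :
    PolyTime fun a => decide (f a = g a) := by
  refine comp (g := fun d : Data × Data => decide (d.1 = d.2)) ?_ (hf.prodMk hg)
  exact ⟨.eq, .X + 3, fun a => ⟨_, by simp [len], .eq _⟩⟩

theorem decide_eq_of_injective [DecidableEq β] (hi : Function.Injective (code : β → Data))
    {f g : α → β} (hf : PolyTime f) (hg : PolyTime g) : PolyTime fun a => decide (f a = g a) :=
  (decide_data_eq (toCode.comp hf) (toCode.comp hg)).congr_code fun a => by simp [hi.eq_iff]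

@[fun_prop]
theorem decide_nat_eq {f g : α → ℕ} (hf : PolyTime f) (hg : PolyTime g) :
    PolyTime fun a => decide (f a = g a) := decide_eq_of_injective Data.ofNat_injective hf hg

@[fun_prop]
theorem not {f : α → Bool} (hf : PolyTime f) : PolyTime fun a => !f a :=
  (hf.bcond (const false) (const true)).congr_code fun a => by cases f a <;> rfl

@[fun_prop]
theorem and {f g : α → Bool} (hf : PolyTime f) (hg : PolyTime g) : PolyTime fun a => f a && g a :=
  (hf.bcond hg (const false)).congr_code fun a => by cases f a <;> rfl

@[fun_prop]
theorem listCons {f : α → β} {g : α → List β} (hf : PolyTime f) (hg : PolyTime g) :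
    PolyTime fun a => f a :: g a :=
  (hf.prodMk hg).congr_code fun _ => rfl

@[fun_prop]
theorem listIsEmpty {f : α → List β} (hf : PolyTime f) : PolyTime fun a => (f a).isEmpty :=
  (decide_data_eq (toCode.comp hf) (const .nil)).congr_code fun a => by
    cases f a <;> simp [code, Data.ofList]

@[fun_prop]
theorem listTail {f : α → List β} (hf : PolyTime f) : PolyTime fun a => (f a).tail :=
  (dataTl.comp (toCode.comp hf)).congr_code fun a => by cases f a <;> rfl

@[fun_prop]
theorem listHeadI [Inhabited β] {f : α → List β} (hf : PolyTime f) : PolyTime fun a => (f a).headI :=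
  ((listIsEmpty hf).bcond (toCode.comp (const default)) (dataHd.comp (toCode.comp hf))).congr_code
    fun a => by cases f a <;> rfl

/-- While loops. -/
theorem iterate {c : β → Bool} {s : β → β} (hc : PolyTime c) (hs : PolyTime s) {i : α → β}
    (hi : PolyTime i) (n : α → ℕ) (p : Polynomial ℕ) (hn : ∀ a, n a ≤ p.eval (len a))
    (hlen : ∀ a, ∀ k ≤ n a, len (s^[k] (i a)) ≤ p.eval (len a))
    (htrue : ∀ a, ∀ k < n a, c (s^[k] (i a)) = true) (hfalse : ∀ a, c (s^[n a] (i a)) = false) :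
    PolyTime fun a => s^[n a] (i a) := by
  obtain ⟨C, q, hC⟩ := hc
  obtain ⟨S, r, hS⟩ := hs
  suffices h : ∃ (P : Program) (q : Polynomial ℕ), ∀ a, ∃ t, t ≤ q.eval (len a) ∧
      P.Runs (code (i a)) (code (s^[n a] (i a))) t by
    obtain ⟨P, u, hP⟩ := h
    obtain ⟨I, v, hI⟩ := hi
    refine ⟨.seq I P, u + v + 1, fun a => ?_⟩
    obtain ⟨t, ht, ht'⟩ := hP a
    obtain ⟨t₂, ht₂, ht₂'⟩ := hI a
    refine ⟨_, ?_, .seq ht₂' ht'⟩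
    simp only [Polynomial.eval_add, Polynomial.eval_one]
    omega
  -- At most `p` rounds and one last test, all on states of length at most `p`.
  refine ⟨.loop C S, (p + 1) * (q.comp p + r.comp p + 1), fun a => ?_⟩
  -- `loop_step` peels off the first round, so the induction is on the number `m` of rounds left.
  have key : ∀ m k, k + m = n a → ∃ t, t ≤ (m + 1) * (q.eval (p.eval (len a)) +
      r.eval (p.eval (len a)) + 1) ∧
      (Program.loop C S).Runs (code (s^[k] (i a))) (code (s^[n a] (i a))) t := by
    intro m
    induction m with
    | zero =>
      intro k hk
      obtain rfl : k = n a := by omega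
      obtain ⟨t, ht, ht'⟩ := hC (s^[n a] (i a))
      rw [hfalse] at ht'
      have := ht.trans (eval_mono q (hlen a _ le_rfl))
      exact ⟨_, by omega, .loop_done ht'⟩
    | succ m ih =>
      intro k hk
      obtain ⟨t, ht, ht'⟩ := hC (s^[k] (i a))
      rw [htrue a k (by omega)] at ht'
      obtain ⟨t₂, ht₂, ht₂'⟩ := hS (s^[k] (i a))
      obtain ⟨t₃, ht₃, ht₃'⟩ := ih (k + 1) (by omega)
      rw [Function.iterate_succ_apply'] at ht₃'
      refine ⟨_, ?_, .loop_step ht' (by simp [code, Data.ofBool]) ht₂' ht₃'⟩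
      have h1 := ht.trans (eval_mono q (hlen a k (by omega)))
      have h2 := ht₂.trans (eval_mono r (hlen a k (by omega)))
      rw [add_mul _ 1]
      omega
  obtain ⟨t, ht, ht'⟩ := key (n a) 0 (by omega)
  refine ⟨t, ht.trans ?_, ht'⟩
  simp only [Polynomial.eval_mul, Polynomial.eval_add, Polynomial.eval_one, Polynomial.eval_comp]
  gcongr
  exact hn a

end PolyTime

/-! ## Recursion along binary trees -/

section TreeRecursion

variable {σ β : Type} [Inhabited σ] [Inhabited β]

/-- One step of the evaluation of a binary recursion: the first component is the stack of pending
problems (`false`) and pending combinations (`true`), the second one the stack of values. -/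
def treeStep (isLeaf : σ → Bool) (leaf : σ → β) (l r : σ → σ) (comb : σ × β × β → β)
    (st : List (Bool × σ) × List β) : List (Bool × σ) × List β :=
  bif st.1.headI.1 then
    -- The left subproblem is solved first, so its value lies below that of the right one.
    (st.1.tail, comb (st.1.headI.2, st.2.tail.headI, st.2.headI) :: st.2.tail.tail)
  else bif isLeaf st.1.headI.2 then
    (st.1.tail, leaf st.1.headI.2 :: st.2)
  else
    ((false, l st.1.headI.2) :: (false, r st.1.headI.2) :: (true, st.1.headI.2) :: st.1.tail, st.2)

variable [Enc σ] [Enc β]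

theorem PolyTime.treeStep {isLeaf : σ → Bool} {leaf : σ → β} {l r : σ → σ} {comb : σ × β × β → β}
    (h₁ : PolyTime isLeaf) (h₂ : PolyTime leaf) (h₃ : PolyTime l) (h₄ : PolyTime r)
    (h₅ : PolyTime comb) : PolyTime (treeStep isLeaf leaf l r comb) := by
  unfold DeepInference.treeStep
  fun_prop

/-- Solving the top problem never touches what lies below it on either stack, so the runs for the
two subproblems can be concatenated. `R` is an invariant of the problems reached, and `N` majorizes
the number of nodes of the recursion tree. -/
theorem treeStep_run {isLeaf : σ → Bool} {leaf : σ → β} {l r : σ → σ} {comb : σ × β × β → β}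
    {F : σ → β} (hleaf : ∀ s, isLeaf s = true → F s = leaf s)
    (hcomb : ∀ s, isLeaf s = false → F s = comb (s, F (l s), F (r s)))
    {R : σ → Prop} (hl : ∀ s, R s → isLeaf s = false → R (l s))
    (hr : ∀ s, R s → isLeaf s = false → R (r s))
    {N : σ → ℕ} (hpos : ∀ s, 1 ≤ N s)
    (hN : ∀ s, R s → isLeaf s = false → N (l s) + N (r s) + 1 ≤ N s)
    {M : ℕ} (hs : ∀ s, R s → len s ≤ M) (hF : ∀ s, R s → len (F s) ≤ M) :
    ∀ n s, N s ≤ n → R s → ∀ (todo : List (Bool × σ)) (vals : List β),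
      ∃ k, k ≤ 3 * N s ∧
        (DeepInference.treeStep isLeaf leaf l r comb)^[k] ((false, s) :: todo, vals) = (todo, F s :: vals) ∧
        ∀ i < k,
          ((DeepInference.treeStep isLeaf leaf l r comb)^[i]
            ((false, s) :: todo, vals)).1.isEmpty = false ∧
          len ((DeepInference.treeStep isLeaf leaf l r comb)^[i] ((false, s) :: todo, vals)) ≤
            len (todo, vals) + 3 * (M + 5) * N s := by
  -- With `K` a variable, the products `K * N s` are atoms for `omega`, while `hK` keeps `K` linear
  -- in `M`.
  obtain ⟨K, hK⟩ : ∃ K, K = 3 * (M + 5) := ⟨_, rfl⟩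
  simp only [← hK]
  set T := DeepInference.treeStep isLeaf leaf l r comb with hT
  have item : ∀ (b : Bool) (s : σ), R s → len (b, s) ≤ M + 4 := fun b s h => by
    have := hs s h
    have := len_bool_le b
    simp only [len_prod]; omega
  intro n
  induction n with
  | zero => intro s h; have := hpos s; omega
  | succ n ih =>
    intro s hn hR todo vals
    have hi := item false s hR
    have hi' := item true s hR
    have hFs := hF s hR
    have hp := hpos s
    cases h : isLeaf s
    · have hl' := hl s hR h
      have hr' := hr s hR h
      have hN' := hN s hR h
      have hil := item false _ hl'
      have hir := item false _ hr'
      have hFl := hF _ hl'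
      obtain ⟨k₁, hk₁, e₁, b₁⟩ := ih (l s) (by omega) hl' ((false, r s) :: (true, s) :: todo) vals
      obtain ⟨k₂, hk₂, e₂, b₂⟩ := ih (r s) (by omega) hr' ((true, s) :: todo) (F (l s) :: vals)
      have e₀ : T ((false, s) :: todo, vals) =
          ((false, l s) :: (false, r s) :: (true, s) :: todo, vals) := by
        simp [hT, DeepInference.treeStep, h]
      have e₃ : T ((true, s) :: todo, F (r s) :: F (l s) :: vals) = (todo, F s :: vals) := by
        simp [hT, DeepInference.treeStep, hcomb s h]
      have f₁ : ∀ i, T^[i + 1] ((false, s) :: todo, vals) =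
          T^[i] ((false, l s) :: (false, r s) :: (true, s) :: todo, vals) := fun i => by
        rw [Function.iterate_succ_apply, e₀]
      have f₂ : ∀ i, T^[i + k₁ + 1] ((false, s) :: todo, vals) =
          T^[i] ((false, r s) :: (true, s) :: todo, F (l s) :: vals) := fun i => by
        rw [f₁, Function.iterate_add_apply, e₁]
      have f₃ : ∀ i, T^[i + k₂ + k₁ + 1] ((false, s) :: todo, vals) =
          T^[i] ((true, s) :: todo, F (r s) :: F (l s) :: vals) := fun i => by
        rw [f₂, Function.iterate_add_apply, e₂]
      have hmul : K * (N (l s) + N (r s) + 1) ≤ K * N s :=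
        Nat.mul_le_mul_left _ hN'
      rw [mul_add, mul_add, mul_one] at hmul
      -- One step splits the problem, `k₁` and `k₂` steps solve the halves, one step combines. The
      -- bounds at time `i` are checked in each phase separately.
      refine ⟨1 + k₂ + k₁ + 1, by omega, by rw [f₃, Function.iterate_one, e₃], fun i hlt => ?_⟩
      rcases Nat.eq_zero_or_pos i with rfl | h0
      · refine ⟨rfl, ?_⟩
        simp only [Function.iterate_zero, _root_.id, len_prod, len_cons] at *
        omega
      obtain ⟨i, rfl⟩ : ∃ j, i = j + 1 := ⟨i - 1, by omega⟩
      by_cases hi₁ : i < k₁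
      · rw [f₁]
        refine ⟨(b₁ i hi₁).1, (b₁ i hi₁).2.trans ?_⟩
        simp only [len_prod, len_cons] at *
        omega
      obtain ⟨i, rfl⟩ : ∃ j, i = j + k₁ := ⟨i - k₁, by omega⟩
      by_cases hi₂ : i < k₂
      · rw [f₂]
        refine ⟨(b₂ i hi₂).1, (b₂ i hi₂).2.trans ?_⟩
        simp only [len_prod, len_cons] at *
        omega
      obtain rfl : i = 0 + k₂ := by omega
      have hFr := hF _ hr'
      rw [f₃]
      refine ⟨rfl, ?_⟩
      simp only [Function.iterate_zero, _root_.id, len_prod, len_cons] at *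
      omega
    · refine ⟨1, by omega, ?_, fun i hi => ?_⟩
      · simp [hT, DeepInference.treeStep, h, hleaf]
      · obtain rfl : i = 0 := by omega
        refine ⟨rfl, ?_⟩
        have : K ≤ K * N s := Nat.le_mul_of_pos_right _ hp
        simp only [Function.iterate_zero, _root_.id, len_prod, len_cons] at *
        omega

/-- Binary recursion on a tree of polynomially many problems, such that the problems and
their solutions are of polynomial size. -/
theorem PolyTime.treeRecursion {α : Type} [Enc α] {isLeaf : σ → Bool} {leaf : σ → β} {l r : σ → σ}
    {comb : σ × β × β → β} {init : α → σ}
    (h₁ : PolyTime isLeaf) (h₂ : PolyTime leaf) (h₃ : PolyTime l) (h₄ : PolyTime r)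
    (h₅ : PolyTime comb) (h₆ : PolyTime init)
    {F : σ → β} (hleaf : ∀ s, isLeaf s = true → F s = leaf s)
    (hcomb : ∀ s, isLeaf s = false → F s = comb (s, F (l s), F (r s)))
    {R : α → σ → Prop} (hinit : ∀ a, R a (init a))
    (hl : ∀ a s, R a s → isLeaf s = false → R a (l s))
    (hr : ∀ a s, R a s → isLeaf s = false → R a (r s))
    {N : σ → ℕ} (hpos : ∀ s, 1 ≤ N s)
    (hN : ∀ a s, R a s → isLeaf s = false → N (l s) + N (r s) + 1 ≤ N s)
    (p : Polynomial ℕ) (hNp : ∀ a, N (init a) ≤ p.eval (len a))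
    (hs : ∀ a s, R a s → len s ≤ p.eval (len a))
    (hF : ∀ a s, R a s → len (F s) ≤ p.eval (len a)) :
    PolyTime fun a => F (init a) := by
  choose k hk e b using fun a => treeStep_run hleaf hcomb (hl a) (hr a) hpos (hN a) (hs a) (hF a)
    _ (init a) le_rfl (hinit a) [] []
  have := PolyTime.iterate (c := fun st : List (Bool × σ) × List β => !st.1.isEmpty)
    (s := DeepInference.treeStep isLeaf leaf l r comb) (i := fun a => ([(false, init a)], []))
    (by fun_prop) (PolyTime.treeStep h₁ h₂ h₃ h₄ h₅) (by fun_prop) k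
    -- The first summand bounds the number of steps, the second the growth of the stacks; `p + 5`
    -- covers the two empty stacks and the final value.
    (3 * p + 3 * (p + 5) * p + p + 5) (fun a => ?_) (fun a i hi => ?_)
    (fun a i hi => by simpa using (b a i hi).1) (fun a => by simp [e])
  · have h := (PolyTime.listHeadI (PolyTime.snd this))
    simpa only [e, List.headI_cons] using h
  · have := (hk a).trans (Nat.mul_le_mul_left 3 (hNp a))
    simp only [Polynomial.eval_add, Polynomial.eval_mul, Polynomial.eval_ofNat]
    omega
  · simp only [Polynomial.eval_add, Polynomial.eval_mul, Polynomial.eval_ofNat]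
    rcases hi.lt_or_eq with h | rfl
    · have h1 := (b a i h).2
      have h2 := Nat.mul_le_mul_left (3 * (p.eval (len a) + 5)) (hNp a)
      simp only [len_prod, len_nil] at h1
      omega
    · have h1 := hF a _ (hinit a)
      rw [e]
      simp only [len_prod, len_cons, len_nil]
      omega

end TreeRecursion

/-! ## Recursion on formulae -/

instance : Inhabited Formula := ⟨.top⟩
instance : Inhabited Derivation := ⟨.fm .top⟩

namespace Formula

def isBin : Formula → Bool
  | and _ _ => true
  | or _ _ => true
  | _ => false

def isAnd : Formula → Bool
  | and _ _ => true
  | _ => false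

def isLit : Formula → Bool
  | lit _ _ => true
  | _ => false

def isTop : Formula → Bool
  | top => true
  | _ => false

def isBot : Formula → Bool
  | bot => true
  | _ => false

/-- The left immediate subformula; the formula itself if there is none. -/
def left : Formula → Formula
  | and A _ => A
  | or A _ => A
  | A => A

/-- The right immediate subformula; the formula itself if there is none. -/
def right : Formula → Formula
  | and _ B => B
  | or _ B => B
  | A => A

/-- The variable of a literal. -/
def var : Formula → ℕ
  | lit x _ => x
  | _ => 0

/-- The polarity of a literal. -/
def pol : Formula → Bool
  | lit _ b => b
  | _ => false

/-- The number of nodes. -/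
def nodes : Formula → ℕ
  | and A B => A.nodes + B.nodes + 1
  | or A B => A.nodes + B.nodes + 1
  | _ => 1

theorem nodes_pos (A : Formula) : 1 ≤ A.nodes := by cases A <;> simp [nodes]

theorem nodes_le_len (A : Formula) : A.nodes ≤ len A := by
  induction A with
  | and A B ihA ihB => simp only [len, Enc.code, code, nodes, Data.size] at *; omega
  | or A B ihA ihB => simp only [len, Enc.code, code, nodes, Data.size] at *; omega
  | _ => exact len_pos _

end Formula

/-! ### Polynomial-time operations on formulae and derivations -/

namespace PolyTime

open Formula hiding code

variable {α β γ : Type} [Enc α] [Enc β] [Enc γ]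

theorem formula_tag {f : α → Formula} (hf : PolyTime f) (n : ℕ) :
    PolyTime fun a => decide ((code (f a)).hd = Data.tag n) :=
  decide_data_eq (dataHd.comp (toCode.comp hf)) (const _)

@[fun_prop]
theorem isAnd {f : α → Formula} (hf : PolyTime f) : PolyTime fun a => (f a).isAnd :=
  (formula_tag hf 3).congr_code fun a => by
    cases f a <;> simp [code, Formula.code, Formula.isAnd, Data.hd, Data.tag]

@[fun_prop]
theorem isLit {f : α → Formula} (hf : PolyTime f) : PolyTime fun a => (f a).isLit :=
  (formula_tag hf 2).congr_code fun a => by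
    cases f a <;> simp [code, Formula.code, Formula.isLit, Data.hd, Data.tag]

@[fun_prop]
theorem isTop {f : α → Formula} (hf : PolyTime f) : PolyTime fun a => (f a).isTop :=
  (formula_tag hf 0).congr_code fun a => by
    cases f a <;> simp [code, Formula.code, Formula.isTop, Data.hd, Data.tag]

@[fun_prop]
theorem isBot {f : α → Formula} (hf : PolyTime f) : PolyTime fun a => (f a).isBot :=
  (formula_tag hf 1).congr_code fun a => by
    cases f a <;> simp [code, Formula.code, Formula.isBot, Data.hd, Data.tag]

@[fun_prop]
theorem isBin {f : α → Formula} (hf : PolyTime f) : PolyTime fun a => (f a).isBin :=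
  ((((isLit hf).not.and (isTop hf).not).and (isBot hf).not)).congr_code fun a => by
    cases f a <;> rfl

@[fun_prop]
theorem left {f : α → Formula} (hf : PolyTime f) : PolyTime fun a => (f a).left :=
  ((isBin hf).bcond (dataHd.comp (dataTl.comp (toCode.comp hf))) (toCode.comp hf)).congr_code
    fun a => by cases f a <;> rfl

@[fun_prop]
theorem right {f : α → Formula} (hf : PolyTime f) : PolyTime fun a => (f a).right :=
  ((isBin hf).bcond (dataTl.comp (dataTl.comp (toCode.comp hf))) (toCode.comp hf)).congr_code
    fun a => by cases f a <;> rfl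

@[fun_prop]
theorem pol {f : α → Formula} (hf : PolyTime f) : PolyTime fun a => (f a).pol :=
  ((isLit hf).bcond (dataHd.comp (dataTl.comp (toCode.comp hf)))
    (toCode.comp (const false))).congr_code fun a => by cases f a <;> rfl

@[fun_prop]
theorem var {f : α → Formula} (hf : PolyTime f) : PolyTime fun a => (f a).var :=
  ((isLit hf).bcond (dataTl.comp (dataTl.comp (toCode.comp hf)))
    (toCode.comp (const 0))).congr_code fun a => by cases f a <;> rfl

theorem formula_cons {f : α → Data} (hf : PolyTime f) (n : ℕ) :
    PolyTime fun a => Data.cons (.tag n) (f a) := dataCons (const (Data.tag n)) hf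

@[fun_prop]
theorem formulaLit {f : α → ℕ} {g : α → Bool} (hf : PolyTime f) (hg : PolyTime g) :
    PolyTime fun a => Formula.lit (f a) (g a) :=
  (formula_cons (dataCons hg hf) 2).congr_code fun _ => rfl

@[fun_prop]
theorem formulaAnd {f g : α → Formula} (hf : PolyTime f) (hg : PolyTime g) :
    PolyTime fun a => Formula.and (f a) (g a) :=
  (formula_cons (dataCons hf hg) 3).congr_code fun _ => rfl

@[fun_prop]
theorem formulaOr {f g : α → Formula} (hf : PolyTime f) (hg : PolyTime g) :
    PolyTime fun a => Formula.or (f a) (g a) :=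
  (formula_cons (dataCons hf hg) 4).congr_code fun _ => rfl

@[fun_prop]
theorem derivationFm {f : α → Formula} (hf : PolyTime f) : PolyTime fun a => Derivation.fm (f a) :=
  (formula_cons (toCode.comp hf) 0).congr_code fun _ => rfl

@[fun_prop]
theorem derivationAnd {f g : α → Derivation} (hf : PolyTime f) (hg : PolyTime g) :
    PolyTime fun a => Derivation.and (f a) (g a) :=
  (formula_cons (dataCons hf hg) 1).congr_code fun _ => rfl

@[fun_prop]
theorem derivationOr {f g : α → Derivation} (hf : PolyTime f) (hg : PolyTime g) :
    PolyTime fun a => Derivation.or (f a) (g a) :=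
  (formula_cons (dataCons hf hg) 2).congr_code fun _ => rfl

@[fun_prop]
theorem derivationStep (ρ : Rule) {f g : α → Derivation} (hf : PolyTime f) (hg : PolyTime g) :
    PolyTime fun a => Derivation.step ρ (f a) (g a) :=
  (formula_cons (dataCons (const ρ) (dataCons hf hg)) 3).congr_code fun _ => rfl

/-- Structural recursion on formulae with a parameter. -/
theorem formulaRecursion [Inhabited γ] [Inhabited β] {F : γ → Formula → β} {leaf : γ × Formula → β}
    {comb : (γ × Formula) × β × β → β} (hl : PolyTime leaf) (hc : PolyTime comb)
    (hleaf : ∀ c A, A.isBin = false → F c A = leaf (c, A))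
    (hand : ∀ c A B, F c (.and A B) = comb ((c, .and A B), F c A, F c B))
    (hor : ∀ c A B, F c (.or A B) = comb ((c, .or A B), F c A, F c B))
    (p : Polynomial ℕ) (hp : ∀ c A, len (F c A) ≤ p.eval (len c + len A))
    {f : α → γ} {g : α → Formula} (hf : PolyTime f) (hg : PolyTime g) :
    PolyTime fun a => F (f a) (g a) := by
  refine comp (g := fun s : γ × Formula => F s.1 s.2) ?_ (hf.prodMk hg)
  refine treeRecursion (isLeaf := fun s : γ × Formula => !s.2.isBin) (leaf := leaf)
    (l := fun s => (s.1, s.2.left)) (r := fun s => (s.1, s.2.right)) (comb := comb)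
    (init := fun s => s) (F := fun s => F s.1 s.2)
    (by fun_prop) hl (by fun_prop) (by fun_prop) hc (by fun_prop) ?_ ?_
    -- The parameter travels unchanged with each subformula, whose code only shrinks.
    (R := fun a s => s.1 = a.1 ∧ len s.2 ≤ len a.2) (fun a => ⟨rfl, le_rfl⟩) ?_ ?_
    (N := fun s => s.2.nodes) (fun s => s.2.nodes_pos) ?_ (p + .X) ?_ ?_ ?_
  · rintro ⟨c, A⟩ h
    exact hleaf c A (by simpa using h)
  · rintro ⟨c, A⟩ h
    cases A with
    | and A B => exact hand c A B
    | or A B => exact hor c A B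
    | _ => simp [Formula.isBin] at h
  · rintro a ⟨c, A⟩ ⟨h1, h2⟩ h
    refine ⟨h1, le_trans ?_ h2⟩
    cases A <;> simp [Formula.left, len, code, Formula.code, Data.size]
    all_goals omega
  · rintro a ⟨c, A⟩ ⟨h1, h2⟩ h
    refine ⟨h1, le_trans ?_ h2⟩
    cases A <;> simp [Formula.right, len, code, Formula.code, Data.size]
    all_goals omega
  · rintro a ⟨c, A⟩ - h
    cases A <;> simp_all [Formula.left, Formula.right, Formula.isBin, nodes]
  · rintro ⟨c, A⟩
    have := A.nodes_le_len
    simp only [len_prod, Polynomial.eval_add, Polynomial.eval_X]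
    omega
  · rintro ⟨c', A'⟩ ⟨c, A⟩ ⟨rfl, h2⟩
    simp only [len_prod, Polynomial.eval_add, Polynomial.eval_X] at *
    omega
  · rintro ⟨c', A'⟩ ⟨c, A⟩ ⟨rfl, h2⟩
    refine (hp c A).trans ?_
    simp only [len_prod, Polynomial.eval_add, Polynomial.eval_X] at *
    exact (eval_mono p (by omega)).trans (Nat.le_add_right _ _)

end PolyTime

/-! ## Auxiliary formulae -/

namespace Formula

/-- Composed from operations already known to be polynomial-time, instead of by pattern matching, so
that `fun_prop` applies. -/
def isPosLit (x : ℕ) (A : Formula) : Bool := A.isLit && (decide (A.var = x) && A.pol)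

def isNegLit (x : ℕ) (A : Formula) : Bool := A.isLit && (decide (A.var = x) && !A.pol)

theorem eq_of_isPosLit {x : ℕ} {A : Formula} (h : A.isPosLit x = true) : A = lit x true := by
  simp only [isPosLit, Bool.and_eq_true, decide_eq_true_eq] at h
  obtain ⟨h₁, rfl, h₂⟩ := h
  cases A <;> simp_all [isLit, var, pol]

theorem eq_of_isNegLit {x : ℕ} {A : Formula} (h : A.isNegLit x = true) : A = lit x false := by
  simp only [isNegLit, Bool.and_eq_true, Bool.not_eq_true', decide_eq_true_eq] at h
  obtain ⟨h₁, rfl, h₂⟩ := h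
  cases A <;> simp_all [isLit, var, pol]

/-- Replaces the literals of the variable `x` by units, according to the value `b` for `x`. -/
def restrict (x : ℕ) (b : Bool) : Formula → Formula
  | and A B => and (A.restrict x b) (B.restrict x b)
  | or A B => or (A.restrict x b) (B.restrict x b)
  | A => bif A.isPosLit x then (bif b then top else bot) else
      bif A.isNegLit x then (bif b then bot else top) else A

/-- The conjunction of all occurrences of the literal dual to `x`. -/
def negPart (x : ℕ) : Formula → Formula
  | and A B => and (A.negPart x) (B.negPart x)
  | or A B => and (A.negPart x) (B.negPart x)
  | A => bif A.isNegLit x then A else top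

/-- The first literal, or some unit if there is none. -/
def firstLit : Formula → Formula
  | and A B => bif A.firstLit.isLit then A.firstLit else B.firstLit
  | or A B => bif A.firstLit.isLit then A.firstLit else B.firstLit
  | A => A

theorem eval_restrict (x : ℕ) (b : Bool) (v : ℕ → Bool) (A : Formula) :
    (A.restrict x b).eval v = A.eval (Function.update v x b) := by
  induction A with
  | lit y c =>
    by_cases h : y = x <;> cases b <;> cases c <;>
      simp [restrict, isPosLit, isNegLit, isLit, var, pol, eval, h]
  | top => rfl
  | bot => rfl
  | and A B ihA ihB => simp [restrict, eval, ihA, ihB]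
  | or A B ihA ihB => simp [restrict, eval, ihA, ihB]

theorem mem_vars_restrict {x y : ℕ} {b : Bool} {A : Formula} (h : y ∈ (A.restrict x b).vars) :
    y ∈ A.vars ∧ y ≠ x := by
  induction A with
  | lit z c =>
    by_cases hz : z = x <;> cases b <;> cases c <;>
      simp_all [restrict, isPosLit, isNegLit, isLit, var, pol, vars]
  | top => simp_all [restrict, isPosLit, isNegLit, isLit, vars]
  | bot => simp_all [restrict, isPosLit, isNegLit, isLit, vars]
  | and A B ihA ihB => simp only [restrict, vars, List.mem_append] at *; tauto
  | or A B ihA ihB => simp only [restrict, vars, List.mem_append] at *; tauto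

theorem size_restrict_le (x : ℕ) (b : Bool) (A : Formula) : (A.restrict x b).size ≤ A.size := by
  induction A with
  | lit z c =>
    by_cases hz : z = x <;> cases b <;> cases c <;>
      simp_all [restrict, isPosLit, isNegLit, isLit, var, pol, size]
  | top => rfl
  | bot => rfl
  | and A B ihA ihB => simp only [restrict, size]; omega
  | or A B ihA ihB => simp only [restrict, size]; omega

/-- Units do not count for `size`; this makes `build` terminate. -/
theorem size_restrict_lt {x : ℕ} (b : Bool) {A : Formula} (h : x ∈ A.vars) :
    (A.restrict x b).size < A.size := by
  induction A with
  | lit z c =>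
    cases b <;> cases c <;>
      simp_all [restrict, isPosLit, isNegLit, isLit, var, pol, size, vars]
  | top => simp [vars] at h
  | bot => simp [vars] at h
  | and A B ihA ihB =>
    have h1 := size_restrict_le x b A
    have h2 := size_restrict_le x b B
    simp only [restrict, size, vars, List.mem_append] at *
    rcases h with h | h
    · have := ihA h; omega
    · have := ihB h; omega
  | or A B ihA ihB =>
    have h1 := size_restrict_le x b A
    have h2 := size_restrict_le x b B
    simp only [restrict, size, vars, List.mem_append] at *
    rcases h with h | h
    · have := ihA h; omega
    · have := ihB h; omega

theorem var_firstLit_mem {A : Formula} (h : A.firstLit.isLit = true) :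
    A.firstLit.var ∈ A.vars := by
  induction A with
  | lit z c => simp [firstLit, var, vars]
  | top => simp [firstLit, isLit] at h
  | bot => simp [firstLit, isLit] at h
  | and A B ihA ihB =>
    cases hA : A.firstLit.isLit <;> simp_all [firstLit, vars]
  | or A B ihA ihB =>
    cases hA : A.firstLit.isLit <;> simp_all [firstLit, vars]

/-- The recursion of `build` is thus no deeper than the number of distinct variables, which is the
exponent in the number of rows. -/
theorem card_vars_restrict_lt (A : Formula) (b : Bool) (h : A.firstLit.isLit = true) :
    (A.restrict A.firstLit.var b).vars.toFinset.card < A.vars.toFinset.card :=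
  Finset.card_lt_card ⟨fun y hy => by
      simpa using (mem_vars_restrict (by simpa using hy)).1,
    fun hs => (mem_vars_restrict (List.mem_toFinset.1
      (hs (List.mem_toFinset.2 (var_firstLit_mem h))))).2 rfl⟩

/-! ### Equational reasoning modulo `Eqv` -/

namespace Eqv

theorem or_congr {A B C D : Formula} (h : Eqv A B) (h' : Eqv C D) : Eqv (or A C) (or B D) :=
  (or_ctx A h').trans ((or_comm _ _).trans ((or_ctx D h).trans (or_comm _ _)))

theorem and_congr {A B C D : Formula} (h : Eqv A B) (h' : Eqv C D) : Eqv (and A C) (and B D) :=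
  (and_ctx A h').trans ((and_comm _ _).trans ((and_ctx D h).trans (and_comm _ _)))

theorem or_or_or_comm (A B C D : Formula) :
    Eqv (or (or A B) (or C D)) (or (or A C) (or B D)) :=
  (or_assoc _ _ _).trans <| (or_ctx A ((or_assoc _ _ _).symm.trans
    ((or_congr (or_comm _ _) (.refl _)).trans (or_assoc _ _ _)))).trans (or_assoc _ _ _).symm

theorem and_and_and_comm (A B C D : Formula) :
    Eqv (and (and A B) (and C D)) (and (and A C) (and B D)) :=
  (and_assoc _ _ _).trans <| (and_ctx A ((and_assoc _ _ _).symm.trans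
    ((and_congr (and_comm _ _) (.refl _)).trans (and_assoc _ _ _)))).trans (and_assoc _ _ _).symm

/-- A formula without literals equals its value. -/
theorem unit_of_firstLit {A : Formula} (h : A.firstLit.isLit = false) (v : ℕ → Bool) :
    Eqv A (bif A.eval v then top else bot) := by
  induction A with
  | top => exact .refl _
  | bot => exact .refl _
  | lit x b => simp [firstLit, isLit] at h
  | and A B ihA ihB =>
    have hA : A.firstLit.isLit = false := by
      cases hA : A.firstLit.isLit <;> simp_all [firstLit]
    have hB : B.firstLit.isLit = false := by simpa [firstLit, hA] using h
    refine (and_congr (ihA hA) (ihB hB)).trans ?_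
    simp only [eval]
    cases A.eval v <;> cases B.eval v
    · exact bot_and_bot
    · exact and_top _
    · exact (and_comm _ _).trans (and_top _)
    · exact and_top _
  | or A B ihA ihB =>
    have hA : A.firstLit.isLit = false := by
      cases hA : A.firstLit.isLit <;> simp_all [firstLit]
    have hB : B.firstLit.isLit = false := by simpa [firstLit, hA] using h
    refine (or_congr (ihA hA) (ihB hB)).trans ?_
    simp only [eval]
    cases A.eval v <;> cases B.eval v
    · exact or_bot _
    · exact (or_comm _ _).trans (or_bot _)
    · exact or_bot _
    · exact top_or_top

end Eqv

end Formula

/-! ## Derivations in `KS` -/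

namespace Derivation

open Formula (Eqv)

/-- `Φ` is a derivation in `KS` from `A` to `B`. -/
def Derives (Φ : Derivation) (A B : Formula) : Prop :=
  Φ.Correct KS ∧ Φ.pr = A ∧ Φ.cn = B

namespace Derives

variable {Φ Ψ : Derivation} {A B C D : Formula}

theorem fm (A : Formula) : Derives (.fm A) A A := ⟨trivial, rfl, rfl⟩

theorem and (h : Derives Φ A B) (h' : Derives Ψ C D) :
    Derives (.and Φ Ψ) (.and A C) (.and B D) :=
  ⟨⟨h.1, h'.1⟩, congrArg₂ _ h.2.1 h'.2.1, congrArg₂ _ h.2.2 h'.2.2⟩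

theorem or (h : Derives Φ A B) (h' : Derives Ψ C D) :
    Derives (.or Φ Ψ) (.or A C) (.or B D) :=
  ⟨⟨h.1, h'.1⟩, congrArg₂ _ h.2.1 h'.2.1, congrArg₂ _ h.2.2 h'.2.2⟩

theorem step {ρ : Rule} (h : Derives Φ A B) (hρ : ρ.Inst B C) (h' : Derives Ψ C D)
    (hS : ρ ∈ KS := by simp [KS]) : Derives (.step ρ Φ Ψ) A D :=
  ⟨⟨h.1, h'.1, hS, by rw [h.2.2, h'.2.1]; exact hρ⟩, h.2.1, h'.2.2⟩

theorem eq (h : Derives Φ A B) (h' : Derives Ψ C D) (hE : Eqv B C) :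
    Derives (.step .eq Φ Ψ) A D := h.step (.eq hE) h'

/-- Vertical composition always goes through an inference step, so plain composition uses a trivial
instance of `=`. -/
theorem comp (h : Derives Φ A B) (h' : Derives Ψ B D) :
    Derives (.step .eq Φ Ψ) A D := h.eq h' (.refl _)

end Derives

/-- Weakening, from `⊥` to `A`. -/
def weak : Formula → Derivation
  | .and A B => step .eq (fm .bot) (and (weak A) (weak B))
  | .or A B => step .eq (fm .bot) (or (weak A) (weak B))
  | A => bif A.isLit then step .weakening (fm .bot) (fm A) else
      bif A.isTop then
        -- Weakening applies to literals only; `⊤` is reached by `⊥ = ⊥ ∧ (⊥ ∨ ⊤) → (⊥ ∧ ⊥) ∨ ⊤ =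
        -- ⊤`.
        step .eq (fm .bot) (step .switch (fm (.and .bot (.or .bot .top)))
          (step .eq (fm (.or (.and .bot .bot) .top)) (fm .top)))
      else fm .bot

theorem weak_derives (A : Formula) : Derives (weak A) .bot A := by
  induction A with
  | top =>
    exact (Derives.fm _).eq ((Derives.fm _).step (.switch _ _ _) ((Derives.fm _).eq (Derives.fm _)
      ((Eqv.or_comm _ _).trans ((Eqv.or_ctx _ .bot_and_bot).trans (.or_bot _)))))
      (.symm ((Eqv.and_ctx _ ((Eqv.or_comm _ _).trans (.or_bot _))).trans (.and_top _)))
  | bot => exact .fm _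
  | lit x b => exact (Derives.fm _).step (.weakening x b) (.fm _)
  | and A B ihA ihB => exact (Derives.fm _).eq (ihA.and ihB) Eqv.bot_and_bot.symm
  | or A B ihA ihB => exact (Derives.fm _).eq (ihA.or ihB) (Eqv.or_bot _).symm

/-- Contraction, from `A ∨ A` to `A`. -/
def contr : Formula → Derivation
  -- Medial turns `(A ∧ B) ∨ (A ∧ B)` into `(A ∨ A) ∧ (B ∨ B)`, so contraction is reduced to atoms.
  | .and A B => step .medial (fm (.or (.and A B) (.and A B))) (and (contr A) (contr B))
  | .or A B => step .eq (fm (.or (.or A B) (.or A B))) (or (contr A) (contr B))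
  | A => bif A.isLit then step .contraction (fm (.or A A)) (fm A) else
      step .eq (fm (.or A A)) (fm A)

theorem contr_derives (A : Formula) : Derives (contr A) (.or A A) A := by
  induction A with
  | top => exact (Derives.fm _).eq (.fm _) .top_or_top
  | bot => exact (Derives.fm _).eq (.fm _) (.or_bot _)
  | lit x b => exact (Derives.fm _).step (.contraction x b) (.fm _)
  | and A B ihA ihB => exact (Derives.fm _).step (.medial _ _ _ _) (ihA.and ihB)
  | or A B ihA ihB => exact (Derives.fm _).eq (ihA.or ihB) (.or_or_or_comm _ _ _ _)

/-- Combines derivations of `A ∨ P` and `B ∨ P` into one of `(A ∧ B) ∨ P`. -/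
def mergeAnd (A B P : Formula) (κ Φ Ψ : Derivation) : Derivation :=
  step .eq
    -- `(A ∨ P) ∧ (B ∨ P) → ((A ∨ P) ∧ B) ∨ P = (B ∧ (A ∨ P)) ∨ P → ((B ∧ A) ∨ P) ∨ P`, and then `κ`
    -- contracts `P ∨ P`.
    (step .switch (and Φ Ψ)
      (or (step .eq (fm (.and (.or A P) B)) (step .switch (fm (.and B (.or A P)))
        (fm (.or (.and B A) P)))) (fm P)))
    (or (fm (.and A B)) κ)

theorem mergeAnd_derives {A B P C D : Formula} {κ Φ Ψ : Derivation}
    (hκ : Derives κ (.or P P) P) (hΦ : Derives Φ C (.or A P)) (hΨ : Derives Ψ D (.or B P)) :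
    Derives (mergeAnd A B P κ Φ Ψ) (.and C D) (.or (.and A B) P) :=
  ((hΦ.and hΨ).step (.switch _ _ _) (((Derives.fm _).eq ((Derives.fm _).step (.switch _ _ _)
    (.fm _)) (.and_comm _ _)).or (.fm _))).eq ((Derives.fm _).or hκ)
    ((Eqv.or_assoc _ _ _).trans (.or_congr (.and_comm _ _) (.refl _)))

/-- Combines derivations of `A ∨ P` and `B ∨ P` into one of `(A ∨ B) ∨ P`. -/
def mergeOr (A B : Formula) (κ Φ Ψ : Derivation) : Derivation :=
  step .eq (or Φ Ψ) (or (fm (.or A B)) κ)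

theorem mergeOr_derives {A B P C D : Formula} {κ Φ Ψ : Derivation}
    (hκ : Derives κ (.or P P) P) (hΦ : Derives Φ C (.or A P)) (hΨ : Derives Ψ D (.or B P)) :
    Derives (mergeOr A B κ Φ Ψ) (.or C D) (.or (.or A B) P) :=
  (hΦ.or hΨ).eq ((Derives.fm _).or hκ) (.or_or_or_comm _ _ _ _)

/-- From `⊤` to `A.negPart x ∨ x`. -/
def exclMid (x : ℕ) : Formula → Derivation
  | .and A B => step .eq (fm .top) (mergeAnd (A.negPart x) (B.negPart x) (.lit x true)
      (contr (.lit x true)) (exclMid x A) (exclMid x B))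
  | .or A B => step .eq (fm .top) (mergeAnd (A.negPart x) (B.negPart x) (.lit x true)
      (contr (.lit x true)) (exclMid x A) (exclMid x B))
  | A => bif A.isNegLit x then step .identity (fm .top) (fm (.or (.lit x false) (.lit x true)))
      else step .eq (fm .top) (or (fm .top) (weak (.lit x true)))

/-- Each conjunct `¬x` arises together with an `x` by identity, and each conjunct `⊤` receives an
`x` by weakening; `mergeAnd` collects the conjuncts and contracts the `x`s. -/
theorem exclMid_derives (x : ℕ) (A : Formula) :
    Derives (exclMid x A) .top (.or (A.negPart x) (.lit x true)) := by
  have leaf : ∀ A : Formula, A.isBin = false →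
      Derives (bif A.isNegLit x then
        step .identity (fm .top) (fm (.or (.lit x false) (.lit x true)))
        else step .eq (fm .top) (or (fm .top) (weak (.lit x true)))) .top
        (.or (bif A.isNegLit x then A else .top) (.lit x true)) := by
    intro A _
    cases h : A.isNegLit x
    · exact (Derives.fm _).eq ((Derives.fm _).or (weak_derives _)) (Eqv.or_bot _).symm
    · obtain rfl := Formula.eq_of_isNegLit h
      exact (Derives.fm _).step (.identity x false) (.fm _)
  induction A with
  | top => exact leaf _ rfl
  | bot => exact leaf _ rfl
  | lit y b => exact leaf _ rfl
  | and A B ihA ihB =>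
    exact (Derives.fm _).eq (mergeAnd_derives (contr_derives _) ihA ihB) (Eqv.and_top _).symm
  | or A B ihA ihB =>
    exact (Derives.fm _).eq (mergeAnd_derives (contr_derives _) ihA ihB) (Eqv.and_top _).symm

/-- From `A.restrict x true` to `A ∨ Y`, given derivations `ι` of `Y ∨ x`, `ω` from `⊥` to `Y` and
`κ` from `Y ∨ Y` to `Y`. -/
def expand (x : ℕ) (Y : Formula) (ι ω κ : Derivation) : Formula → Derivation
  | .and A B => mergeAnd A B Y κ (expand x Y ι ω κ A) (expand x Y ι ω κ B)
  | .or A B => mergeOr A B κ (expand x Y ι ω κ A) (expand x Y ι ω κ B)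
  | A => bif A.isPosLit x then step .eq ι (fm (.or A Y)) else
      bif A.isNegLit x then step .eq (fm .bot) (or (weak A) ω) else
      step .eq (fm A) (or (fm A) ω)

/-- `Y` stays fixed along the induction, so each leaf obtains its own copy, and each connective
merges two copies into one. -/
theorem expand_derives {x : ℕ} {Y : Formula} {ι ω κ : Derivation}
    (hι : Derives ι .top (.or Y (.lit x true))) (hω : Derives ω .bot Y)
    (hκ : Derives κ (.or Y Y) Y) (A : Formula) :
    Derives (expand x Y ι ω κ A) (A.restrict x true) (.or A Y) := by
  have leaf : ∀ A : Formula, A.isBin = false →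
      Derives (bif A.isPosLit x then step .eq ι (fm (.or A Y)) else
        bif A.isNegLit x then step .eq (fm .bot) (or (weak A) ω) else
        step .eq (fm A) (or (fm A) ω))
        (bif A.isPosLit x then .top else bif A.isNegLit x then .bot else A) (.or A Y) := by
    intro A _
    cases h : A.isPosLit x
    · cases h' : A.isNegLit x
      · exact (Derives.fm _).eq ((Derives.fm _).or hω) (Eqv.or_bot _).symm
      · exact (Derives.fm _).eq ((weak_derives _).or hω) (Eqv.or_bot _).symm
    · obtain rfl := Formula.eq_of_isPosLit h
      exact hι.eq (.fm _) (.or_comm _ _)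
  induction A with
  | top => exact leaf _ rfl
  | bot => exact leaf _ rfl
  | lit y b => exact leaf _ rfl
  | and A B ihA ihB => exact mergeAnd_derives hκ ihA ihB
  | or A B ihA ihB => exact mergeOr_derives hκ ihA ihB

/-- From `A.negPart x ∧ A.restrict x false` to `A`. -/
def assemble (x : ℕ) : Formula → Derivation
  | .and A B => step .eq
      (fm (.and (.and (A.negPart x) (B.negPart x)) (.and (A.restrict x false) (B.restrict x false))))
      (and (assemble x A) (assemble x B))
  -- With primes for restrictions and `P`, `Q` for the negative parts of `A`, `B`: `(P ∧ Q) ∧ (A' ∨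
  -- B') = P ∧ (Q ∧ (B' ∨ A')) → P ∧ ((Q ∧ B') ∨ A') → (P ∧ A') ∨ (Q ∧ B')`.
  | .or A B => step .eq
      (fm (.and (.and (A.negPart x) (B.negPart x)) (.or (A.restrict x false) (B.restrict x false))))
      (step .eq
        (and (fm (A.negPart x))
          (step .switch (fm (.and (B.negPart x) (.or (B.restrict x false) (A.restrict x false))))
            (fm (.or (.and (B.negPart x) (B.restrict x false)) (A.restrict x false)))))
        (step .switch
          (fm (.and (A.negPart x)
            (.or (A.restrict x false) (.and (B.negPart x) (B.restrict x false)))))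
          (or (assemble x A) (assemble x B))))
  | A => bif A.isPosLit x then step .eq (fm (.and .top .bot)) (weak A) else
      step .eq (fm (.and (A.negPart x) (A.restrict x false))) (fm A)

/-- Leaf by leaf, the premiss is `¬x ∧ ⊤` for `¬x`, `⊤ ∧ ⊥` for `x`, and `⊤ ∧ a` for any other `a`;
the connectives only have to distribute the conjuncts. -/
theorem assemble_derives (x : ℕ) (A : Formula) :
    Derives (assemble x A) (.and (A.negPart x) (A.restrict x false)) A := by
  induction A with
  | top => exact (Derives.fm _).eq (.fm _) (.and_top _)
  | bot => exact (Derives.fm _).eq (.fm _) ((Eqv.and_comm _ _).trans (.and_top _))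
  | lit y b =>
    by_cases hy : y = x
    · subst hy
      cases b
      · have h : Derives (step .eq (fm (.and (.lit y false) .top)) (fm (.lit y false)))
            (.and (.lit y false) .top) (.lit y false) := (Derives.fm _).eq (.fm _) (.and_top _)
        simpa [assemble, Formula.isPosLit, Formula.isNegLit, Formula.isLit, Formula.var,
          Formula.pol, Formula.negPart, Formula.restrict] using h
      · have h : Derives (step .eq (fm (.and .top .bot)) (weak (.lit y true)))
            (.and .top .bot) (.lit y true) :=
          (Derives.fm _).eq (weak_derives _) ((Eqv.and_comm _ _).trans (.and_top _))
        simpa [assemble, Formula.isPosLit, Formula.isNegLit, Formula.isLit, Formula.var,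
          Formula.pol, Formula.negPart, Formula.restrict] using h
    · have h : Derives (step .eq (fm (.and .top (.lit y b))) (fm (.lit y b)))
            (.and .top (.lit y b)) (.lit y b) :=
        (Derives.fm _).eq (.fm _) ((Eqv.and_comm _ _).trans (.and_top _))
      simpa [assemble, Formula.isPosLit, Formula.isNegLit, Formula.isLit, Formula.var,
        Formula.pol, Formula.negPart, Formula.restrict, hy] using h
  | and A B ihA ihB => exact (Derives.fm _).eq (ihA.and ihB) (.and_and_and_comm _ _ _ _)
  | or A B ihA ihB =>
    exact (Derives.fm _).eq (((Derives.fm _).and ((Derives.fm _).step (.switch _ _ _) (.fm _))).eq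
      ((Derives.fm _).step (.switch _ _ _) (ihA.or ihB)) (.and_ctx _ (.or_comm _ _)))
      ((Eqv.and_assoc _ _ _).trans (.and_ctx _ (.and_ctx _ (.or_comm _ _))))

/-- Combines proofs of `A.restrict x true` and `A.restrict x false` into a proof of `A`. -/
def shannon (x : ℕ) (A : Formula) (Φ Ψ : Derivation) : Derivation :=
  step .eq
    (step .eq Φ (expand x (A.negPart x) (exclMid x A) (weak (A.negPart x)) (contr (A.negPart x)) A))
    (step .eq (or (fm A) (step .eq (and (fm (A.negPart x)) Ψ) (assemble x A))) (contr A))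

theorem shannon_derives {x : ℕ} {A : Formula} {Φ Ψ : Derivation}
    (hΦ : Derives Φ .top (A.restrict x true)) (hΨ : Derives Ψ .top (A.restrict x false)) :
    Derives (shannon x A Φ Ψ) .top A :=
  (hΦ.comp (expand_derives (exclMid_derives x A) (weak_derives _) (contr_derives _) A)).eq
    (((Derives.fm _).or (((Derives.fm _).and hΨ).comp (assemble_derives x A))).comp
      (contr_derives A)) (.or_ctx _ (Eqv.and_top _).symm)

/-- A proof of the tautology `A`, by case distinction on the variables. -/
def build (A : Formula) : Derivation :=
  if _h : A.firstLit.isLit = true then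
    shannon A.firstLit.var A (build (A.restrict A.firstLit.var true))
      (build (A.restrict A.firstLit.var false))
  else step .eq (fm .top) (fm A)
termination_by A.size
decreasing_by
  all_goals exact Formula.size_restrict_lt _ (Formula.var_firstLit_mem _h)

theorem build_derives {A : Formula} (hA : ∀ v, A.eval v = true) : Derives (build A) .top A := by
  rw [build]
  split
  next h =>
    exact shannon_derives
      (build_derives fun v => by rw [Formula.eval_restrict]; exact hA _)
      (build_derives fun v => by rw [Formula.eval_restrict]; exact hA _)
  next h =>
    refine (Derives.fm _).eq (.fm _) (Eqv.symm ?_)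
    simpa [hA] using Eqv.unit_of_firstLit (A := A) (by simpa using h) (fun _ => true)
termination_by A.size
decreasing_by
  all_goals exact Formula.size_restrict_lt _ (Formula.var_firstLit_mem ‹_›)

end Derivation

/-! ## Size bounds -/

/-- The size of a formula when the variable `x` counts for `w x`. -/
def Formula.msize (w : ℕ → ℕ) : Formula → ℕ
  | top => 1
  | bot => 1
  | lit x _ => w x + 1
  | and A B => A.msize w + B.msize w + 1
  | or A B => A.msize w + B.msize w + 1

/-- The size of a derivation when the variable `x` counts for `w x`. -/
def Derivation.msize (w : ℕ → ℕ) : Derivation → ℕ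
  | fm A => A.msize w + 1
  | and Φ Ψ => Φ.msize w + Ψ.msize w + 1
  | or Φ Ψ => Φ.msize w + Ψ.msize w + 1
  | step _ Φ Ψ => Φ.msize w + Ψ.msize w + 1

namespace Formula

theorem msize_pos (w : ℕ → ℕ) (A : Formula) : 1 ≤ A.msize w := by
  cases A <;> simp [msize]

/-- The weight `len` makes `msize` comparable to the code length, and the weight `1` makes it a
bound for the number of atoms. Bounds proved for arbitrary weights thus serve both running time and
proof size. -/
theorem msize_len_le (A : Formula) : A.msize len ≤ len A := by
  induction A with
  | lit x b =>
    simp only [msize, len, Enc.code, code, Data.size]; omega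
  | top => simp [msize, len, Enc.code, code, Data.size]
  | bot => simp [msize, len, Enc.code, code, Data.size]
  | and A B ihA ihB => simp only [msize, len, Enc.code, code, Data.size] at *; omega
  | or A B ihA ihB => simp only [msize, len, Enc.code, code, Data.size] at *; omega

/-- A disjunction costs most: its tag has size 9, and two `cons` nodes are added. -/
theorem len_le (A : Formula) : len A ≤ 11 * A.msize len := by
  induction A with
  | lit x b =>
    have := len_bool_le b
    simp only [msize, len, Enc.code, code, Data.size, Data.tag] at *; omega
  | top => simp [msize, len, Enc.code, code, Data.size, Data.tag]
  | bot => simp [msize, len, Enc.code, code, Data.size, Data.tag]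
  | and A B ihA ihB => simp only [msize, len, Enc.code, code, Data.size, Data.tag] at *; omega
  | or A B ihA ihB => simp only [msize, len, Enc.code, code, Data.size, Data.tag] at *; omega

theorem size_le_msize (A : Formula) : A.size ≤ A.msize fun _ => 1 := by
  induction A with
  | and A B ihA ihB => simp only [msize, size]; omega
  | or A B ihA ihB => simp only [msize, size]; omega
  | _ => simp [msize, size]

theorem msize_restrict_le (w : ℕ → ℕ) (x : ℕ) (b : Bool) (A : Formula) :
    (A.restrict x b).msize w ≤ A.msize w := by
  have leaf : ∀ A : Formula, (bif A.isPosLit x then (bif b then top else bot) else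
      bif A.isNegLit x then (bif b then bot else top) else A).msize w ≤ A.msize w := by
    intro A
    have := A.msize_pos w
    cases A.isPosLit x <;> cases A.isNegLit x <;> cases b <;> simp [msize, this]
  induction A with
  | and A B ihA ihB => simp only [restrict, msize]; omega
  | or A B ihA ihB => simp only [restrict, msize]; omega
  | _ => exact leaf _

theorem msize_negPart_le (w : ℕ → ℕ) (x : ℕ) (A : Formula) :
    (A.negPart x).msize w ≤ A.msize w := by
  have leaf : ∀ A : Formula, (bif A.isNegLit x then A else top).msize w ≤ A.msize w := by
    intro A
    have := A.msize_pos w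
    cases A.isNegLit x
    · simpa [msize] using this
    · simp
  induction A with
  | and A B ihA ihB => simp only [negPart, msize]; omega
  | or A B ihA ihB => simp only [negPart, msize]; omega
  | _ => exact leaf _

theorem msize_firstLit_le (w : ℕ → ℕ) (A : Formula) : A.firstLit.msize w ≤ A.msize w := by
  induction A with
  | and A B ihA ihB =>
    cases h : A.firstLit.isLit <;> simp only [firstLit, msize, h, cond_true, cond_false] <;> omega
  | or A B ihA ihB =>
    cases h : A.firstLit.isLit <;> simp only [firstLit, msize, h, cond_true, cond_false] <;> omega
  | _ => exact le_rfl

end Formula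

/-! ### Sizes of the derivations constructed -/

namespace Derivation

theorem msize_pos (w : ℕ → ℕ) (Φ : Derivation) : 1 ≤ Φ.msize w := by
  cases Φ <;> simp [msize]

/-- A `step` costs most: 7 for its tag, at most 17 for the rule, 3 for the `cons` nodes. -/
theorem len_le (Φ : Derivation) : len Φ ≤ 27 * Φ.msize len := by
  induction Φ with
  | fm A =>
    have := A.len_le
    simp only [msize, len, Enc.code, code, Data.size, Data.tag] at *; omega
  | and Φ Ψ ihΦ ihΨ => simp only [msize, len, Enc.code, code, Data.size, Data.tag] at *; omega
  | or Φ Ψ ihΦ ihΨ => simp only [msize, len, Enc.code, code, Data.size, Data.tag] at *; omega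
  | step ρ Φ Ψ ihΦ ihΨ =>
    have : ρ.code.size ≤ 17 := by cases ρ <;> simp [Rule.code, Data.tag, Data.size]
    simp only [msize, len, Enc.code, code, Data.size, Data.tag] at *; omega

theorem size_le_msize (Φ : Derivation) : Φ.size ≤ Φ.msize fun _ => 1 := by
  induction Φ with
  | fm A => have := A.size_le_msize; simp only [msize, size]; omega
  | and Φ Ψ ihΦ ihΨ => simp only [msize, size]; omega
  | or Φ Ψ ihΦ ihΨ => simp only [msize, size]; omega
  | step ρ Φ Ψ ihΦ ihΨ => simp only [msize, size]; omega

variable (w : ℕ → ℕ)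

/-- The factor is determined by the derivation of `⊤` from `⊥`, which has size 19. -/
theorem msize_weak_le (A : Formula) : (weak A).msize w ≤ 20 * A.msize w := by
  induction A with
  | and A B ihA ihB => simp only [weak, msize, Formula.msize]; omega
  | or A B ihA ihB => simp only [weak, msize, Formula.msize]; omega
  | _ => simp [weak, msize, Formula.msize, Formula.isLit, Formula.isTop]; try omega

/-- Every level writes `A ∨ A` out again, hence the square; a unit gives exactly 7. -/
theorem msize_contr_le (A : Formula) : (contr A).msize w ≤ 7 * A.msize w ^ 2 := by
  induction A with
  | and A B ihA ihB => simp only [contr, msize, Formula.msize]; nlinarith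
  | or A B ihA ihB => simp only [contr, msize, Formula.msize]; nlinarith
  | lit x b => simp only [contr, msize, Formula.msize, Formula.isLit, cond_true]; nlinarith
  | _ => simp [contr, msize, Formula.msize, Formula.isLit]

theorem msize_mergeAnd (A B P : Formula) (κ Φ Ψ : Derivation) :
    (mergeAnd A B P κ Φ Ψ).msize w = Φ.msize w + Ψ.msize w + κ.msize w +
      4 * (A.msize w + B.msize w + P.msize w) + 19 := by
  simp only [mergeAnd, msize, Formula.msize]; omega

theorem msize_mergeOr (A B : Formula) (κ Φ Ψ : Derivation) :
    (mergeOr A B κ Φ Ψ).msize w = Φ.msize w + Ψ.msize w + κ.msize w + A.msize w + B.msize w + 5 := by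
  simp only [mergeOr, msize, Formula.msize]; omega

/-- The second factor is a cost per node. It is expressed by a bound `M` for the whole formula so
that it stays constant during the induction; the next bounds follow the same pattern. -/
theorem msize_exclMid_le (x : ℕ) {M : ℕ} (A : Formula) (hM : A.msize w ≤ M) :
    (exclMid x A).msize w ≤ A.msize w * (4 * M + 7 * w x + 33) := by
  have leaf : ∀ A : Formula, (bif A.isNegLit x then
      step .identity (fm .top) (fm (.or (.lit x false) (.lit x true)))
      else step .eq (fm .top) (or (fm .top) (weak (.lit x true)))).msize w ≤
        A.msize w * (4 * M + 7 * w x + 33) := by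
    intro A
    refine le_trans ?_ (Nat.le_mul_of_pos_left _ (A.msize_pos w))
    cases A.isNegLit x <;> simp only [cond_true, cond_false, msize, Formula.msize, weak, Formula.isLit] <;>
      omega
  induction A with
  | and A B ihA ihB =>
    simp only [Formula.msize] at hM
    have hA := ihA (by omega)
    have hB := ihB (by omega)
    have h1 := A.msize_negPart_le w x
    have h2 := B.msize_negPart_le w x
    simp only [exclMid, msize, msize_mergeAnd, Formula.msize, contr, Formula.isLit, cond_true]
    rw [add_one_mul (A.msize w + B.msize w), add_mul (A.msize w)]
    omega
  | or A B ihA ihB =>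
    simp only [Formula.msize] at hM
    have hA := ihA (by omega)
    have hB := ihB (by omega)
    have h1 := A.msize_negPart_le w x
    have h2 := B.msize_negPart_le w x
    simp only [exclMid, msize, msize_mergeAnd, Formula.msize, contr, Formula.isLit, cond_true]
    rw [add_one_mul (A.msize w + B.msize w), add_mul (A.msize w)]
    omega
  | _ => exact leaf _

theorem msize_expand_le (x : ℕ) (Y : Formula) (ι ω κ : Derivation) {M : ℕ} (A : Formula)
    (hM : A.msize w ≤ M) : (expand x Y ι ω κ A).msize w ≤
      A.msize w * (ι.msize w + ω.msize w + κ.msize w + 20 * M + 4 * Y.msize w + 25) := by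
  have leaf : ∀ A : Formula, A.msize w ≤ M → (bif A.isPosLit x then step .eq ι (fm (.or A Y)) else
      bif A.isNegLit x then step .eq (fm .bot) (or (weak A) ω) else
      step .eq (fm A) (or (fm A) ω)).msize w ≤
      A.msize w * (ι.msize w + ω.msize w + κ.msize w + 20 * M + 4 * Y.msize w + 25) := by
    intro A hM
    refine le_trans ?_ (Nat.le_mul_of_pos_left _ (A.msize_pos w))
    have := msize_weak_le w A
    cases A.isPosLit x <;> cases A.isNegLit x <;>
      simp only [cond_true, cond_false, msize, Formula.msize] <;> omega
  induction A with
  | and A B ihA ihB =>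
    simp only [Formula.msize] at hM
    have hA := ihA (by omega)
    have hB := ihB (by omega)
    simp only [expand, msize_mergeAnd, Formula.msize]
    rw [add_one_mul (A.msize w + B.msize w), add_mul (A.msize w)]
    omega
  | or A B ihA ihB =>
    simp only [Formula.msize] at hM
    have hA := ihA (by omega)
    have hB := ihB (by omega)
    simp only [expand, msize_mergeOr, Formula.msize]
    rw [add_one_mul (A.msize w + B.msize w), add_mul (A.msize w)]
    omega
  | _ => exact leaf _ hM

theorem msize_assemble_le (x : ℕ) {M : ℕ} (A : Formula) (hM : A.msize w ≤ M) :
    (assemble x A).msize w ≤ A.msize w * (20 * M + 40) := by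
  have leaf : ∀ A : Formula, A.msize w ≤ M →
      (bif A.isPosLit x then step .eq (fm (.and .top .bot)) (weak A) else
      step .eq (fm (.and (A.negPart x) (A.restrict x false))) (fm A)).msize w ≤
        A.msize w * (20 * M + 40) := by
    intro A hM
    refine le_trans ?_ (Nat.le_mul_of_pos_left _ (A.msize_pos w))
    have := msize_weak_le w A
    have h1 := A.msize_negPart_le w x
    have h2 := A.msize_restrict_le w x false
    cases A.isPosLit x <;> simp only [cond_true, cond_false, msize, Formula.msize] <;> omega
  induction A with
  | and A B ihA ihB =>
    simp only [Formula.msize] at hM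
    have hA := ihA (by omega)
    have hB := ihB (by omega)
    have h1 := A.msize_negPart_le w x
    have h2 := A.msize_restrict_le w x false
    have h3 := B.msize_negPart_le w x
    have h4 := B.msize_restrict_le w x false
    simp only [assemble, msize, Formula.msize]
    rw [add_one_mul (A.msize w + B.msize w), add_mul (A.msize w)]
    omega
  | or A B ihA ihB =>
    simp only [Formula.msize] at hM
    have hA := ihA (by omega)
    have hB := ihB (by omega)
    have h1 := A.msize_negPart_le w x
    have h2 := A.msize_restrict_le w x false
    have h3 := B.msize_negPart_le w x
    have h4 := B.msize_restrict_le w x false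
    simp only [assemble, msize, Formula.msize]
    rw [add_one_mul (A.msize w + B.msize w), add_mul (A.msize w)]
    omega
  | _ => exact leaf _ hM

theorem msize_shannon_le (x : ℕ) (A : Formula) (hx : w x ≤ A.msize w) (Φ Ψ : Derivation) :
    (shannon x A Φ Ψ).msize w ≤ Φ.msize w + Ψ.msize w + 300 * A.msize w ^ 3 := by
  have hM := A.msize_pos w
  have hY := A.msize_negPart_le w x
  have hι := msize_exclMid_le w x A le_rfl
  have hω := msize_weak_le w (A.negPart x)
  have hκ := msize_contr_le w (A.negPart x)
  have hc := msize_contr_le w A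
  have he := msize_expand_le w x (A.negPart x) (exclMid x A) (weak (A.negPart x))
    (contr (A.negPart x)) A le_rfl
  have ha := msize_assemble_le w x A le_rfl
  simp only [shannon, msize]
  set M := A.msize w
  -- `44 = 4 + 7 + 33`, by `w x ≤ M` and `1 ≤ M`.
  have hι' : (exclMid x A).msize w ≤ 44 * M ^ 2 := by nlinarith
  have hκ' : (contr (A.negPart x)).msize w ≤ 7 * M ^ 2 :=
    hκ.trans (Nat.mul_le_mul_left _ (Nat.pow_le_pow_left hY 2))
  have h12 : M ≤ M ^ 2 := by nlinarith
  have h23 : M ^ 2 ≤ M ^ 3 := Nat.pow_le_pow_right hM (by norm_num)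
  -- `120 = 44 + 20 + 7 + 20 + 4 + 25`, one summand for each term of `he`.
  have he' : (expand x (A.negPart x) (exclMid x A) (weak (A.negPart x))
    (contr (A.negPart x)) A).msize w ≤ M * (120 * M ^ 2) :=
    he.trans (Nat.mul_le_mul_left _ (by omega))
  have ha' : (assemble x A).msize w ≤ 60 * M ^ 2 := by nlinarith
  have : M * (120 * M ^ 2) = 120 * M ^ 3 := by ring
  omega

/-- One more variable at most doubles the size and adds `c = 300 * M ^ 3`. Adding `c` to the
left-hand side turns this recurrence into plain doubling. -/
theorem msize_build_le {k M : ℕ} (A : Formula) (hk : A.vars.toFinset.card ≤ k)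
    (hM : A.msize w ≤ M) : (build A).msize w + 300 * M ^ 3 ≤ 2 ^ (k + 1) * (300 * M ^ 3) := by
  have hpos := A.msize_pos w
  have hM3 : M ≤ M ^ 3 := Nat.le_self_pow (by norm_num) M
  have hM3' : A.msize w ^ 3 ≤ M ^ 3 := Nat.pow_le_pow_left hM 3
  rw [build]
  split
  next h =>
    set x := A.firstLit.var with hx
    have hmem : x ∈ A.vars := Formula.var_firstLit_mem h
    have hwx : w x ≤ A.msize w := by
      refine le_trans ?_ (A.msize_firstLit_le w)
      rw [hx]
      cases h' : A.firstLit <;> simp_all [Formula.msize, Formula.var, Formula.isLit]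
    have hsub : ∀ b, (A.restrict x b).vars.toFinset.card < A.vars.toFinset.card := fun b =>
      A.card_vars_restrict_lt b h
    obtain ⟨k, rfl⟩ : ∃ j, k = j + 1 := ⟨k - 1, by have := hsub true; omega⟩
    have h1 := msize_build_le (k := k) (A.restrict x true) (by have := hsub true; omega)
      ((A.msize_restrict_le w x true).trans hM)
    have h2 := msize_build_le (k := k) (A.restrict x false) (by have := hsub false; omega)
      ((A.msize_restrict_le w x false).trans hM)
    have h3 := msize_shannon_le w x A hwx (build (A.restrict x true)) (build (A.restrict x false))
    rw [pow_succ 2 (k + 1), mul_right_comm]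
    omega
  next h =>
    have : 2 * (300 * M ^ 3) ≤ 2 ^ (k + 1) * (300 * M ^ 3) :=
      Nat.mul_le_mul_right _ (Nat.le_self_pow (by omega) 2)
    simp only [msize, Formula.msize]
    omega
termination_by A.size
decreasing_by
  all_goals exact Formula.size_restrict_lt _ hmem

end Derivation

/-! ## The transformations are polynomial-time -/

theorem Derivation.msize_len_le (Φ : Derivation) : Φ.msize len ≤ len Φ := by
  induction Φ with
  | fm A =>
    have := A.msize_len_le
    simp only [msize, len, Enc.code, code, Data.size] at *; omega
  | and Φ Ψ ihΦ ihΨ => simp only [msize, len, Enc.code, code, Data.size] at *; omega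
  | or Φ Ψ ihΦ ihΨ => simp only [msize, len, Enc.code, code, Data.size] at *; omega
  | step ρ Φ Ψ ihΦ ihΨ => simp only [msize, len, Enc.code, code, Data.size] at *; omega

theorem Derivation.len_le_of_msize_le {Φ : Derivation} {m n : ℕ} (h : Φ.msize len ≤ m)
    (hmn : m ≤ n) : len Φ ≤ 27 * n :=
  Φ.len_le.trans (Nat.mul_le_mul_left _ (h.trans hmn))

namespace PolyTime

variable {α : Type} [Enc α]

@[fun_prop]
theorem isPosLit {f : α → ℕ} {g : α → Formula} (hf : PolyTime f) (hg : PolyTime g) :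
    PolyTime fun a => (g a).isPosLit (f a) := by
  unfold Formula.isPosLit; fun_prop

@[fun_prop]
theorem isNegLit {f : α → ℕ} {g : α → Formula} (hf : PolyTime f) (hg : PolyTime g) :
    PolyTime fun a => (g a).isNegLit (f a) := by
  unfold Formula.isNegLit; fun_prop

@[fun_prop]
theorem restrict {f : α → ℕ} {b : α → Bool} {g : α → Formula} (hf : PolyTime f) (hb : PolyTime b)
    (hg : PolyTime g) : PolyTime fun a => (g a).restrict (f a) (b a) := by
  refine formulaRecursion (F := fun (c : ℕ × Bool) A => A.restrict c.1 c.2)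
    (leaf := fun s => bif s.2.isPosLit s.1.1 then (bif s.1.2 then .top else .bot) else
      bif s.2.isNegLit s.1.1 then (bif s.1.2 then .bot else .top) else s.2)
    (comb := fun s => bif s.1.2.isAnd then .and s.2.1 s.2.2 else .or s.2.1 s.2.2)
    (by fun_prop) (by fun_prop) (fun c A h => ?_) (fun c A B => rfl) (fun c A B => rfl)
    (11 * .X) (fun c A => ?_) (hf.prodMk hb) hg
  · cases A <;> first | rfl | simp [Formula.isBin] at h
  · have := (A.restrict c.1 c.2).len_le
    have := A.msize_restrict_le len c.1 c.2
    have := A.msize_len_le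
    simp only [Polynomial.eval_mul, Polynomial.eval_ofNat, Polynomial.eval_X]
    omega

@[fun_prop]
theorem negPart {f : α → ℕ} {g : α → Formula} (hf : PolyTime f) (hg : PolyTime g) :
    PolyTime fun a => (g a).negPart (f a) := by
  refine formulaRecursion (F := fun (c : ℕ) A => A.negPart c)
    (leaf := fun s => bif s.2.isNegLit s.1 then s.2 else .top)
    (comb := fun s => .and s.2.1 s.2.2)
    (by fun_prop) (by fun_prop) (fun c A h => ?_) (fun c A B => rfl) (fun c A B => rfl)
    (11 * .X) (fun c A => ?_) hf hg
  · cases A <;> first | rfl | simp [Formula.isBin] at h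
  · have := (A.negPart c).len_le
    have := A.msize_negPart_le len c
    have := A.msize_len_le
    simp only [Polynomial.eval_mul, Polynomial.eval_ofNat, Polynomial.eval_X]
    omega

@[fun_prop]
theorem firstLit {g : α → Formula} (hg : PolyTime g) : PolyTime fun a => (g a).firstLit := by
  -- A dummy Boolean takes the place of the parameter.
  refine formulaRecursion (F := fun (_ : Bool) A => A.firstLit)
    (leaf := fun s => s.2) (comb := fun s => bif s.2.1.isLit then s.2.1 else s.2.2)
    (by fun_prop) (by fun_prop) (fun c A h => ?_) (fun c A B => rfl) (fun c A B => rfl)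
    (11 * .X) (fun c A => ?_) (const false) hg
  · cases A <;> first | rfl | simp [Formula.isBin] at h
  · have := A.firstLit.len_le
    have := A.msize_firstLit_le len
    have := A.msize_len_le
    simp only [Polynomial.eval_mul, Polynomial.eval_ofNat, Polynomial.eval_X]
    omega

open DeepInference.Derivation (fm step)

@[fun_prop]
theorem weak {g : α → Formula} (hg : PolyTime g) : PolyTime fun a => Derivation.weak (g a) := by
  refine formulaRecursion (F := fun (_ : Bool) A => Derivation.weak A)
    (leaf := fun s => bif s.2.isLit then step .weakening (fm .bot) (fm s.2) else
      bif s.2.isTop then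
        step .eq (fm .bot) (step .switch (fm (.and .bot (.or .bot .top)))
          (step .eq (fm (.or (.and .bot .bot) .top)) (fm .top)))
      else fm .bot)
    (comb := fun s => bif s.1.2.isAnd then step .eq (fm .bot) (.and s.2.1 s.2.2) else
      step .eq (fm .bot) (.or s.2.1 s.2.2))
    (by fun_prop) (by fun_prop) (fun c A h => ?_) (fun c A B => rfl) (fun c A B => rfl)
    (27 * (20 * .X)) (fun c A => ?_) (const false) hg
  · cases A <;> first | rfl | simp [Formula.isBin] at h
  · have h := A.msize_len_le
    simp only [Polynomial.eval_mul, Polynomial.eval_ofNat, Polynomial.eval_X]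
    exact Derivation.len_le_of_msize_le (Derivation.msize_weak_le len A) (by omega)

@[fun_prop]
theorem contr {g : α → Formula} (hg : PolyTime g) : PolyTime fun a => Derivation.contr (g a) := by
  refine formulaRecursion (F := fun (_ : Bool) A => Derivation.contr A)
    (leaf := fun s => bif s.2.isLit then step .contraction (fm (.or s.2 s.2)) (fm s.2) else
      step .eq (fm (.or s.2 s.2)) (fm s.2))
    (comb := fun s =>
      bif s.1.2.isAnd then step .medial (fm (.or s.1.2 s.1.2)) (.and s.2.1 s.2.2) else
      step .eq (fm (.or s.1.2 s.1.2)) (.or s.2.1 s.2.2))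
    (by fun_prop) (by fun_prop) (fun c A h => ?_) (fun c A B => rfl) (fun c A B => rfl)
    (27 * (7 * .X ^ 2)) (fun c A => ?_) (const false) hg
  · cases A <;> first | rfl | simp [Formula.isBin] at h
  · have h : A.msize len ≤ len c + len A := A.msize_len_le.trans (Nat.le_add_left _ _)
    simp only [Polynomial.eval_mul, Polynomial.eval_ofNat, Polynomial.eval_X, Polynomial.eval_pow]
    exact Derivation.len_le_of_msize_le (Derivation.msize_contr_le len A) (by gcongr)

@[fun_prop]
theorem mergeAnd {f g h : α → Formula} {u v w : α → Derivation} (hf : PolyTime f)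
    (hg : PolyTime g) (hh : PolyTime h) (hu : PolyTime u) (hv : PolyTime v) (hw : PolyTime w) :
    PolyTime fun a => Derivation.mergeAnd (f a) (g a) (h a) (u a) (v a) (w a) := by
  unfold Derivation.mergeAnd; fun_prop

@[fun_prop]
theorem mergeOr {f g : α → Formula} {u v w : α → Derivation} (hf : PolyTime f)
    (hg : PolyTime g) (hu : PolyTime u) (hv : PolyTime v) (hw : PolyTime w) :
    PolyTime fun a => Derivation.mergeOr (f a) (g a) (u a) (v a) (w a) := by
  unfold Derivation.mergeOr; fun_prop

@[fun_prop]
theorem exclMid {f : α → ℕ} {g : α → Formula} (hf : PolyTime f) (hg : PolyTime g) :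
    PolyTime fun a => Derivation.exclMid (f a) (g a) := by
  refine formulaRecursion (F := Derivation.exclMid)
    (leaf := fun s => bif s.2.isNegLit s.1 then
      step .identity (fm .top) (fm (.or (.lit s.1 false) (.lit s.1 true)))
      else step .eq (fm .top) (.or (fm .top) (Derivation.weak (.lit s.1 true))))
    (comb := fun s => step .eq (fm .top)
      (Derivation.mergeAnd (s.1.2.left.negPart s.1.1) (s.1.2.right.negPart s.1.1) (.lit s.1.1 true)
        (Derivation.contr (.lit s.1.1 true)) s.2.1 s.2.2))
    (by fun_prop) (by fun_prop) (fun c A h => ?_) (fun c A B => rfl) (fun c A B => rfl)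
    (27 * (.X * (4 * .X + 7 * .X + 33))) (fun c A => ?_) hf hg
  · cases A <;> first | rfl | simp [Formula.isBin] at h
  · have h : A.msize len ≤ len c + len A := A.msize_len_le.trans (Nat.le_add_left _ _)
    simp only [Polynomial.eval_mul, Polynomial.eval_ofNat, Polynomial.eval_X, Polynomial.eval_add]
    exact Derivation.len_le_of_msize_le (Derivation.msize_exclMid_le len c A h)
      (Nat.mul_le_mul h (by omega))

@[fun_prop]
theorem expand {f : α → ℕ} {g h : α → Formula} {u v w : α → Derivation} (hf : PolyTime f)
    (hg : PolyTime g) (hu : PolyTime u) (hv : PolyTime v) (hw : PolyTime w) (hh : PolyTime h) :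
    PolyTime fun a => Derivation.expand (f a) (g a) (u a) (v a) (w a) (h a) := by
  refine formulaRecursion
    (F := fun (c : ℕ × Formula × Derivation × Derivation × Derivation) A =>
      Derivation.expand c.1 c.2.1 c.2.2.1 c.2.2.2.1 c.2.2.2.2 A)
    (leaf := fun s => bif s.2.isPosLit s.1.1 then step .eq s.1.2.2.1 (fm (.or s.2 s.1.2.1)) else
      bif s.2.isNegLit s.1.1 then step .eq (fm .bot) (.or (Derivation.weak s.2) s.1.2.2.2.1) else
      step .eq (fm s.2) (.or (fm s.2) s.1.2.2.2.1))
    (comb := fun s => bif s.1.2.isAnd then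
      Derivation.mergeAnd s.1.2.left s.1.2.right s.1.1.2.1 s.1.1.2.2.2.2 s.2.1 s.2.2 else
      Derivation.mergeOr s.1.2.left s.1.2.right s.1.1.2.2.2.2 s.2.1 s.2.2)
    (by fun_prop) (by fun_prop) (fun c A h => ?_) (fun c A B => rfl) (fun c A B => rfl)
    -- The derivations `ι`, `ω`, `κ` belong to the parameter, so their sizes are bounded by its
    -- length.
    (27 * (.X * (.X + .X + .X + 20 * .X + 4 * .X + 25))) (fun c A => ?_)
    (hf.prodMk (hg.prodMk (hu.prodMk (hv.prodMk hw)))) hh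
  · cases A <;> first | rfl | simp [Formula.isBin] at h
  · have h : A.msize len ≤ len c + len A := A.msize_len_le.trans (Nat.le_add_left _ _)
    obtain ⟨x, Y, ι, ω, κ⟩ := c
    have h1 := Y.msize_len_le
    have h2 := ι.msize_len_le
    have h3 := ω.msize_len_le
    have h4 := κ.msize_len_le
    simp only [Polynomial.eval_mul, Polynomial.eval_ofNat, Polynomial.eval_X, Polynomial.eval_add]
    refine Derivation.len_le_of_msize_le (Derivation.msize_expand_le len _ _ _ _ _ A h)
      (Nat.mul_le_mul h ?_)
    simp only [len_prod]
    omega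

@[fun_prop]
theorem assemble {f : α → ℕ} {g : α → Formula} (hf : PolyTime f) (hg : PolyTime g) :
    PolyTime fun a => Derivation.assemble (f a) (g a) := by
  refine formulaRecursion (F := Derivation.assemble)
    (leaf := fun s => bif s.2.isPosLit s.1 then step .eq (fm (.and .top .bot)) (Derivation.weak s.2)
      else step .eq (fm (.and (s.2.negPart s.1) (s.2.restrict s.1 false))) (fm s.2))
    (comb := fun ⟨⟨x, A⟩, Φ, Ψ⟩ => bif A.isAnd then
      step .eq
        (fm (.and (.and (A.left.negPart x) (A.right.negPart x))
          (.and (A.left.restrict x false) (A.right.restrict x false))))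
        (.and Φ Ψ) else
      step .eq
        (fm (.and (.and (A.left.negPart x) (A.right.negPart x))
          (.or (A.left.restrict x false) (A.right.restrict x false))))
        (step .eq
          (.and (fm (A.left.negPart x))
            (step .switch
              (fm (.and (A.right.negPart x)
                (.or (A.right.restrict x false) (A.left.restrict x false))))
              (fm (.or (.and (A.right.negPart x) (A.right.restrict x false))
                (A.left.restrict x false)))))
          (step .switch
            (fm (.and (A.left.negPart x)
              (.or (A.left.restrict x false) (.and (A.right.negPart x) (A.right.restrict x false)))))
            (.or Φ Ψ))))
    (by fun_prop) (by fun_prop) (fun c A h => ?_) (fun c A B => rfl) (fun c A B => rfl)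
    (27 * (.X * (20 * .X + 40))) (fun c A => ?_) hf hg
  · cases A <;> first | rfl | simp [Formula.isBin] at h
  · have h : A.msize len ≤ len c + len A := A.msize_len_le.trans (Nat.le_add_left _ _)
    simp only [Polynomial.eval_mul, Polynomial.eval_ofNat, Polynomial.eval_X, Polynomial.eval_add]
    exact Derivation.len_le_of_msize_le (Derivation.msize_assemble_le len c A h)
      (Nat.mul_le_mul_right _ h)

@[fun_prop]
theorem shannon {f : α → ℕ} {g : α → Formula} {u v : α → Derivation} (hf : PolyTime f)
    (hg : PolyTime g) (hu : PolyTime u) (hv : PolyTime v) :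
    PolyTime fun a => Derivation.shannon (f a) (g a) (u a) (v a) := by
  unfold Derivation.shannon; fun_prop

end PolyTime

/-! ## Truth tables -/

namespace Formula

theorem getLast?_subformulas (A : Formula) : A.subformulas.getLast? = some A := by
  cases A <;> simp [subformulas]

/-- A literal of weight one counts 2, every other node 1. -/
theorem msize_one_le (A : Formula) : A.msize (fun _ => 1) ≤ 2 * A.subformulas.length := by
  induction A <;> simp [msize, subformulas]
  all_goals omega

end Formula

namespace TruthTable

variable {T : TruthTable}

theorem IsProof.eval_eq_true (h : T.IsProof) (v : ℕ → Bool) : T.formula.eval v = true := by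
  have := h.2.2 _ ((h.2.1 _).2 ⟨v, rfl⟩)
  simpa [row, columns, List.getLast?_append, Formula.getLast?_subformulas] using this

/-- Assignments that differ on a variable of the formula have different rows, because that variable
has a column. -/
theorem IsProof.two_pow_le (h : T.IsProof) : 2 ^ T.formula.vars.toFinset.card ≤ T.rows.length := by
  set S := T.formula.vars.toFinset
  let ext : (S → Bool) → ℕ → Bool := fun f x => if hx : x ∈ S then f ⟨x, hx⟩ else false
  have hcard : (Finset.univ : Finset (S → Bool)).card ≤ T.rows.toFinset.card := by
    refine Finset.card_le_card_of_injOn (fun f => row T.formula (ext f)) (fun f _ => ?_) ?_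
    · simpa using (h.2.1 _).2 ⟨ext f, rfl⟩
    · intro f _ g _ hfg
      funext ⟨x, hx⟩
      have hmem : Formula.lit x true ∈ columns T.formula := by
        simp only [columns, List.mem_append, List.mem_map, List.mem_dedup]
        exact .inl ⟨x, List.mem_toFinset.1 hx, rfl⟩
      have := List.map_inj_left.1 hfg _ hmem
      simpa [Formula.eval, ext, hx] using this
  have := hcard.trans (List.toFinset_card_le _)
  simpa using this

theorem IsProof.size_eq (h : T.IsProof) : T.size = T.rows.length * (columns T.formula).length := by
  have : T.rows.map List.length = T.rows.map fun _ => (columns T.formula).length :=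
    List.map_congr_left fun r hr => by
      obtain ⟨v, rfl⟩ := (h.2.1 r).1 hr
      simp [row]
  rw [size, this]
  simp

theorem length_rows_le (h : T.IsProof) :
    T.rows.length ≤ len (⟨T, h⟩ : {T : TruthTable // T.IsProof}) := by
  have key : ∀ l : List Data, l.length ≤ (Data.ofList l).size := by
    intro l
    induction l with
    | nil => simp
    | cons a l ih => simp only [List.length_cons, Data.ofList, Data.size]; omega
  have := key (T.rows.map fun r => .ofList (r.map Data.ofBool))
  simp only [len, Enc.code, code, Data.size, List.length_map] at *
  omega

theorem len_formula_le (h : T.IsProof) :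
    len T.formula ≤ len (⟨T, h⟩ : {T : TruthTable // T.IsProof}) := by
  simp only [len, Enc.code, code, Data.size]
  omega

end TruthTable

/-- Only the formula is read from the table; the rows serve to make exponential time in the number
of variables polynomial in the input. -/
theorem PolyTime.build_formula :
    PolyTime fun T : {T : TruthTable // T.IsProof} => Derivation.build T.1.formula := by
  refine PolyTime.treeRecursion (isLeaf := fun A : Formula => !A.firstLit.isLit)
    (leaf := fun A => .step .eq (.fm .top) (.fm A))
    (l := fun A => A.restrict A.firstLit.var true) (r := fun A => A.restrict A.firstLit.var false)
    (comb := fun s => Derivation.shannon s.1.firstLit.var s.1 s.2.1 s.2.2)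
    (init := fun T : {T : TruthTable // T.IsProof} => T.1.formula)
    (by fun_prop) (by fun_prop) (by fun_prop) (by fun_prop) (by fun_prop)
    ((PolyTime.dataHd.comp PolyTime.toCode).congr_code fun _ => rfl)
    (F := Derivation.build) (fun A h => ?_) (fun A h => ?_)
    (R := fun T A => A.vars.toFinset.card ≤ T.1.formula.vars.toFinset.card ∧
      A.msize len ≤ T.1.formula.msize len)
    (fun _ => ⟨le_rfl, le_rfl⟩)
    (fun _ A h h' => ⟨(A.card_vars_restrict_lt _ (by simpa using h')).le.trans h.1,
      (A.msize_restrict_le _ _ _).trans h.2⟩)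
    (fun _ A h h' => ⟨(A.card_vars_restrict_lt _ (by simpa using h')).le.trans h.1,
      (A.msize_restrict_le _ _ _).trans h.2⟩)
    -- The number of nodes of the full binary tree whose depth is the number of variables.
    (N := fun A => 2 ^ (A.vars.toFinset.card + 1) - 1) (fun A => ?_) (fun _ A _ h => ?_)
    -- The summands bound the number of subproblems, the codes of the restricted formulae and the
    -- codes of their proofs, respectively.
    (2 * .X + 11 * .X + 27 * (2 * .X * (300 * .X ^ 3))) ?_ ?_ ?_
  · rw [Derivation.build, dif_neg (by simpa using h)]
  · rw [Derivation.build, dif_pos (by simpa using h)]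
  · have := Nat.pow_le_pow_right (n := 2) (by norm_num) (Nat.le_add_left 1 A.vars.toFinset.card)
    omega
  · have h1 := A.card_vars_restrict_lt true (by simpa using h)
    have h2 := A.card_vars_restrict_lt false (by simpa using h)
    have h3 := Nat.pow_le_pow_right (n := 2) (by norm_num) h1
    have h4 := Nat.pow_le_pow_right (n := 2) (by norm_num) h2
    simp only [Nat.succ_eq_add_one, pow_succ] at *
    have := Nat.one_le_two_pow (n := (A.restrict A.firstLit.var true).vars.toFinset.card)
    have := Nat.one_le_two_pow (n := (A.restrict A.firstLit.var false).vars.toFinset.card)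
    omega
  · rintro ⟨T, hT⟩
    have h1 := hT.two_pow_le
    have h2 := TruthTable.length_rows_le hT
    simp only [Polynomial.eval_mul, Polynomial.eval_ofNat, Polynomial.eval_X, Polynomial.eval_add,
      pow_succ]
    omega
  · rintro ⟨T, hT⟩ A ⟨-, h⟩
    have h1 := A.len_le
    have h2 := T.formula.msize_len_le
    have h3 := TruthTable.len_formula_le hT
    simp only [Polynomial.eval_mul, Polynomial.eval_ofNat, Polynomial.eval_X, Polynomial.eval_add] at *
    omega
  · rintro ⟨T, hT⟩ A ⟨hk, hM⟩
    have h1 := hT.two_pow_le.trans (TruthTable.length_rows_le hT)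
    have h2 := T.formula.msize_len_le.trans (TruthTable.len_formula_le hT)
    have h3 := Derivation.msize_build_le len A hk (hM.trans h2)
    set n := len (⟨T, hT⟩ : {T : TruthTable // T.IsProof})
    have h4 : 2 ^ (T.formula.vars.toFinset.card + 1) * (300 * n ^ 3) ≤ 2 * n * (300 * n ^ 3) :=
      Nat.mul_le_mul_right _ (by rw [pow_succ]; omega)
    have h5 := Derivation.len_le_of_msize_le ((Nat.le_add_right _ _).trans h3) h4
    simp only [Polynomial.eval_mul, Polynomial.eval_ofNat, Polynomial.eval_X, Polynomial.eval_add,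
      Polynomial.eval_pow]
    omega

/-- Both the number of rows and the number of subformula occurrences are at most `T.size`, as the
table has a row and a column. The former bounds `2 ^ k`, and twice the latter bounds `M`. -/
theorem TruthTable.IsProof.size_build_le {T : TruthTable} (hT : T.IsProof) :
    (Derivation.build T.formula).size ≤ 2 * T.size * (300 * (2 * T.size) ^ 3) := by
  have hrow := hT.two_pow_le
  have hpos : 1 ≤ T.rows.length := Nat.one_le_two_pow.trans hrow
  have hsub : 1 ≤ T.formula.subformulas.length := by
    cases T.formula <;> simp [Formula.subformulas] <;> omega
  have hcol : T.formula.subformulas.length ≤ (TruthTable.columns T.formula).length := by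
    simp [TruthTable.columns]
  have h1 : T.rows.length ≤ T.size := by
    rw [hT.size_eq]; exact Nat.le_mul_of_pos_right _ (hsub.trans hcol)
  have h2 : T.formula.subformulas.length ≤ T.size := by
    rw [hT.size_eq]; exact hcol.trans (Nat.le_mul_of_pos_left _ hpos)
  have h3 := T.formula.msize_one_le
  have h4 := Derivation.msize_build_le (fun _ => 1) T.formula le_rfl
    (h3.trans (Nat.mul_le_mul_left 2 h2))
  refine (Derivation.size_le_msize _).trans (((Nat.le_add_right _ _).trans h4).trans
    (Nat.mul_le_mul_right _ ?_))
  rw [pow_succ]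
  omega

end DeepInference

/-! ### The simulation theorem -/

theorem mainTheorem7 :
    DeepInference.PolynomiallySimulates
      (DeepInference.deepInference DeepInference.KS) DeepInference.truthTables := by
  obtain ⟨P, q, hP⟩ := DeepInference.PolyTime.build_formula
  refine ⟨P, 2 * .X * (300 * (2 * .X) ^ 3), q, fun T hT => ?_⟩
  obtain ⟨hC, hpr, hcn⟩ := DeepInference.Derivation.build_derives hT.eval_eq_true
  obtain ⟨t, ht, hr⟩ := hP ⟨T, hT⟩
  refine ⟨DeepInference.Derivation.build T.formula, ⟨hC, hpr⟩, hcn, ?_, t, ht, hr⟩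
  simp only [Polynomial.eval_mul, Polynomial.eval_ofNat, Polynomial.eval_X, Polynomial.eval_pow]
  exact hT.size_build_le
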